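/- Let $\alpha\in(0,1)$, $p\in[1,2]$, $a_-,a_+,\lambda_-,\lambda_+>0$. Call a real random variable $\theta$ tempered stable if $$\mathbb E[e^{it\theta}]=\exp\Big(\int_{\mathbb R}\big(e^{itx}-1-i\kappa(x)tx\big)\,\lambda(dx)\Big),\qquad t\in\mathbb R,$$ where $\kappa(x)=1$ for $|x|<1$, $\kappa(x)=1/|x|$ for $|x|\ge 1$, and $$\lambda(dx)=a_-\frac{e^{-\lambda_-|x|}}{|x|^{1+\alpha}}\mathbf 1_{\{x<0\}}\,dx+a_+\frac{e^{-\lambda_+x}}{x^{1+\alpha}}\mathbf 1_{\{x>0\}}\,dx .$$ Let $(\omega_n)_{n\ge0}$ be a bounded sequence of positive reals, let $k_0>0$ and $k_n:=k_0\prod_{l=0}^{n-1}1/\omega_l$ for $n\ge1$, and assume $\sum_n k_n^\alpha<\infty$. Let $\theta_{1,n},\theta_{2,n}$ $(n\ge0)$ be independent tempered stable random variables with the above law. Then the series $\sum_{n\ge0}k_n(\theta_{1,n}+i\theta_{2,n})e_n$, where $(e_n)$ is the canonical basis, converges almost surely in the complex Banach space $E=\ell^p(\mathbb N)$ to an $E$-valued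 random variable; let $\mu$ be its law on $E$. Let $T$ be the bounded weighted backward shift on $E$ given by $Te_0=0$, $Te_{n+1}=\omega_ne_n$, and let $T^*$ be its adjoint on the continuous dual $E^*$, $\langle z,T^*y^*\rangle=\langle Tz,y^*\rangle$. For every $x^*\in E^*$ the function $t\mapsto\int_E e^{it\,\mathrm{Re}\langle z,x^*\rangle}\mu(dz)$ has no zero on $\mathbb R$; for a real function $f$ of the form $f(z)=\mathrm{Re}\langle z,x^*\rangle$, $x^*\in E^*$ (for instance $f=-\mathrm{Im}\langle\cdot,y^*\rangle$), let $\log\int_E e^{if}d\mu$ be the value at $t=1$ of the continuous branch of $t\mapsto\log\int_E e^{itf}d\mu$ that vanishes at $t=0$. For $x^*,y^*\in E^*$ define the codifferences $$C^=_\mu(x^*,y^*)=\log\int_E e^{i\mathrm{Re}\langle z,x^*-y^*\rangle}\mu(dz)-\log\int_E e^{i\mathrm{Re}\langle z,x^*\rangle}\mu(dz)-\log\int_E e^{-i\mathrm{Re}\langle z,y^*\rangle}\mu(dz),$$ $$C^{\ne}_\mu(x^*,y^*)=\log\int_E e^{i\mathrm{Re}\langle z,x^*\rangle-i\mathrm{Im}\langle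 z,y^*\rangle}\mu(dz)-\log\int_E e^{i\mathrm{Re}\langle z,x^*\rangle}\mu(dz)-\log\int_E e^{-i\mathrm{Im}\langle z,y^*\rangle}\mu(dz).$$ Then: 1. $T$ leaves $\mu$ invariant. 2. For every $n\ge0$ the sum $\sum_l k_l^{p/2}k_{l+n}^{p/2}$ is finite, and for both $C_\mu=C_\mu^=$ and $C_\mu=C_\mu^{\ne}$, $$\sup_{x^*,y^*\in E^*\setminus\{0\}}\frac{|C_\mu(x^*,T^{*n}y^*)|}{\|x^*\|^{p/2}\|y^*\|^{p/2}}\le 2^{5-p}\big(a_-\lambda_-^{\alpha-p}+a_+\lambda_+^{\alpha-p}\big)\Gamma(p-\alpha)\sum_{l=0}^\infty k_l^{p/2}k_{l+n}^{p/2}.$$ 3. If $\lim_{n\to\infty}\sum_{l=0}^\infty k_l^{p/2}k_{l+n}^{p/2}=0$, then $T$ is (strongly) mixing with respect to $\mu$: $T$ preserves $\mu$ and $\mu(A\cap T^{-n}(B))\to\mu(A)\mu(B)$ for all Borel sets $A,B\subset E$. -/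

import Mathlib

open MeasureTheory ProbabilityTheory Filter Topology
open scoped ENNReal

/-! ### Strong mixing -/

/-- `T` preserves `μ` and is strongly mixing: `μ (A ∩ T⁻ⁿ B) → μ A * μ B` for all measurable `A`
and `B`. -/
def IsStronglyMixing {E : Type*} [MeasurableSpace E] (T : E → E) (μ : Measure E) : Prop :=
  MeasurePreserving T μ μ ∧
    ∀ A B : Set E, MeasurableSet A → MeasurableSet B →
      Tendsto (fun n : ℕ => μ (A ∩ T^[n] ⁻¹' B)) atTop (𝓝 (μ A * μ B))

/-! ### Logarithms of characteristic functions and codifferences -/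

/-- `L` is the continuous branch of `log ∘ φ` on the real line that vanishes at `0`
(so that necessarily `φ 0 = 1` and `φ` has no zeros). -/
def IsLogBranch (φ L : ℝ → ℂ) : Prop :=
  Continuous L ∧ L 0 = 0 ∧ ∀ t, Complex.exp (L t) = φ t

/-- The continuous branch vanishing at `0` is unique. -/
theorem IsLogBranch.unique {φ L M : ℝ → ℂ} (hL : IsLogBranch φ L) (hM : IsLogBranch φ M) :
    L = M := by
  obtain ⟨hLc, hL0, hLe⟩ := hL
  obtain ⟨hMc, hM0, hMe⟩ := hM
  have key := Complex.isCoveringMap_exp.eq_of_comp_eq (g₁ := L) (g₂ := M) hLc hMc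
    (by
      funext t
      apply Subtype.ext
      simp [hLe, hMe]) 0 (by rw [hL0, hM0])
  exact key

/-- The characteristic function `t ↦ ∫ exp (i t f) dμ` of the real function `f` under `μ`. -/
noncomputable def charPath {E : Type*} [MeasurableSpace E] (μ : Measure E) (f : E → ℝ) (t : ℝ) :
    ℂ :=
  ∫ z, Complex.exp (Complex.I * ((t * f z : ℝ) : ℂ)) ∂μ

open Classical in
/-- `log ∫ exp (i f) dμ`, where `log` is the distinguished logarithm used for infinitely divisible
laws: the value at `t = 1` of the continuous branch of `t ↦ log ∫ exp (i t f) dμ` vanishing at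
`t = 0`. (By convention it is `0` when no such branch exists, that is, when the characteristic
function has a zero.) -/
noncomputable def logChar {E : Type*} [MeasurableSpace E] (μ : Measure E) (f : E → ℝ) : ℂ :=
  if h : ∃ L, IsLogBranch (charPath μ f) L then h.choose 1 else 0

/-- Any continuous branch computes `logChar`. -/
theorem IsLogBranch.logChar_eq {E : Type*} [MeasurableSpace E] {μ : Measure E} {f : E → ℝ}
    {L : ℝ → ℂ} (hL : IsLogBranch (charPath μ f) L) : logChar μ f = L 1 := by
  have h : ∃ L, IsLogBranch (charPath μ f) L := ⟨L, hL⟩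
  rw [logChar, dif_pos h, h.choose_spec.unique hL]

section Codifference

variable {E : Type*} [NormedAddCommGroup E] [NormedSpace ℂ E] [MeasurableSpace E]

/-- The codifference `C^=_μ(x*, y*)`. -/
noncomputable def codiffEq (μ : Measure E) (x y : StrongDual ℂ E) : ℂ :=
  logChar μ (fun z => ((x - y) z).re) - logChar μ (fun z => (x z).re)
    - logChar μ (fun z => -(y z).re)

/-- The codifference `C^≠_μ(x*, y*)`. -/
noncomputable def codiffNe (μ : Measure E) (x y : StrongDual ℂ E) : ℂ :=
  logChar μ (fun z => (x z).re - (y z).im) - logChar μ (fun z => (x z).re)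
    - logChar μ (fun z => -(y z).im)

end Codifference

/-! ### Tempered stable laws on the real line -/

/-- The truncation function `κ`. -/
noncomputable def truncation (x : ℝ) : ℝ := if |x| < 1 then 1 else 1 / |x|

/-- The density of the tempered stable Lévy measure
`aNeg e^{-lNeg |x|} |x|^{-1-α} 1_{x<0} + aPos e^{-lPos x} x^{-1-α} 1_{x>0}`. -/
noncomputable def temperedStableDensity (α aNeg aPos lNeg lPos x : ℝ) : ℝ :=
  if x < 0 then aNeg * (Real.exp (-lNeg * |x|) / |x| ^ (1 + α))
  else if 0 < x then aPos * (Real.exp (-lPos * x) / x ^ (1 + α))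
  else 0

/-- The tempered stable Lévy measure. -/
noncomputable def temperedStableLevy (α aNeg aPos lNeg lPos : ℝ) : Measure ℝ :=
  volume.withDensity fun x => ENNReal.ofReal (temperedStableDensity α aNeg aPos lNeg lPos x)

/-- `ν` is the tempered stable law with characteristic function
`exp (∫ (e^{itx} - 1 - i κ(x) t x) λ(dx))`, with `λ` the tempered stable Lévy measure. -/
def IsTemperedStable (α aNeg aPos lNeg lPos : ℝ) (ν : Measure ℝ) : Prop :=
  IsProbabilityMeasure ν ∧ ∀ t : ℝ, charFun ν t =
    Complex.exp (∫ x : ℝ, (Complex.exp (Complex.I * t * x) - 1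
      - Complex.I * truncation x * t * x) ∂(temperedStableLevy α aNeg aPos lNeg lPos))

/-! ### The sequence space, the backward shift and the random series -/

/-- The complex sequence space `ℓ^p(ℕ)`. -/
abbrev SeqSpace (p : ℝ≥0∞) : Type := lp (fun _ : ℕ => ℂ) p

/-- The canonical vector `c • e_n` of `ℓ^p(ℕ)`. -/
noncomputable abbrev seqSingle (p : ℝ≥0∞) (n : ℕ) (c : ℂ) : SeqSpace p :=
  lp.single (E := fun _ : ℕ => ℂ) p n c

/-- `k_n = k₀ ∏_{l<n} 1/ω_l`. -/
noncomputable def shiftCoeff (k₀ : ℝ) (ω : ℕ → ℝ) (n : ℕ) : ℝ :=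
  k₀ * ∏ l ∈ Finset.range n, 1 / ω l

section Shift

variable {p : ℝ≥0∞}

theorem norm_weight_mul_le {ω : ℕ → ℝ} (hpos : ∀ n, 0 < ω n) (hbdd : BddAbove (Set.range ω))
    (z : ℕ → ℂ) (n : ℕ) : ‖(ω n : ℂ) * z (n + 1)‖ ≤ ‖((⨆ m, ω m : ℝ) : ℂ) * z (n + 1)‖ := by
  have h1 : ω n ≤ ⨆ m, ω m := le_ciSup hbdd n
  have h2 : 0 ≤ ⨆ m, ω m := (hpos n).le.trans h1
  rw [norm_mul, norm_mul, Complex.norm_real, Complex.norm_real, Real.norm_of_nonneg (hpos n).le,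
    Real.norm_of_nonneg h2]
  gcongr

theorem memℓp_tail {z : ℕ → ℂ} (hp1 : 1 ≤ p) (hz : Memℓp z p) :
    Memℓp (fun n => z (n + 1)) p := by
  rcases eq_or_ne p ∞ with rfl | hp
  · rw [memℓp_infty_iff] at hz ⊢
    exact hz.mono (by rintro _ ⟨n, rfl⟩; exact ⟨n + 1, rfl⟩)
  · have h0 : 0 < p.toReal := ENNReal.toReal_pos (by positivity) hp
    rw [memℓp_gen_iff h0] at hz ⊢
    exact (summable_nat_add_iff (f := fun n => ‖z n‖ ^ p.toReal) 1).2 hz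

/-- The tail map `(z_n) ↦ (z_{n+1})` on `ℓ^p(ℕ)`. -/
noncomputable def tailSeq [Fact (1 ≤ p)] (z : SeqSpace p) : SeqSpace p :=
  ⟨fun n => z (n + 1), memℓp_tail Fact.out (lp.memℓp z)⟩

theorem norm_tailSeq_le [Fact (1 ≤ p)] (z : SeqSpace p) : ‖tailSeq z‖ ≤ ‖z‖ := by
  rcases eq_or_ne p ∞ with rfl | hp
  · exact lp.norm_le_of_forall_le (norm_nonneg _)
      fun n => lp.norm_apply_le_norm (by simp) z (n + 1)
  · have h1 : 1 ≤ p := Fact.out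
    have h0 : 0 < p.toReal := ENNReal.toReal_pos (by positivity) hp
    refine lp.norm_le_of_tsum_le h0 (norm_nonneg _) ?_
    have hs : Summable fun n => ‖z n‖ ^ p.toReal := (memℓp_gen_iff h0).1 (lp.memℓp z)
    rw [lp.norm_rpow_eq_tsum h0, hs.tsum_eq_zero_add]
    exact le_add_of_nonneg_left (by positivity)

/-- The weighted backward shift on `ℓ^p(ℕ)` with bounded positive weights `ω`, as a bounded
operator: `(T z)_n = ω_n z_{n+1}`. -/
noncomputable def backwardShift (p : ℝ≥0∞) [Fact (1 ≤ p)] (ω : ℕ → ℝ) (hpos : ∀ n, 0 < ω n)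
    (hbdd : BddAbove (Set.range ω)) : SeqSpace p →L[ℂ] SeqSpace p :=
  LinearMap.mkContinuous
    { toFun := fun z => ⟨fun n => (ω n : ℂ) * z (n + 1),
        ((lp.memℓp (tailSeq z)).const_mul ((⨆ m, ω m : ℝ) : ℂ)).mono'
          fun n => norm_weight_mul_le hpos hbdd z n⟩
      map_add' := fun x y => by
        ext n
        change (ω n : ℂ) * (x (n + 1) + y (n + 1)) = ω n * x (n + 1) + ω n * y (n + 1)
        ring
      map_smul' := fun c x => by
        ext n
        change (ω n : ℂ) * (c * x (n + 1)) = c * (ω n * x (n + 1))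
        ring }
    (⨆ m, ω m)
    (fun z => by
      have h2 : 0 ≤ ⨆ m, ω m := (hpos 0).le.trans (le_ciSup hbdd 0)
      refine (lp.norm_mono (y := ((⨆ m, ω m : ℝ) : ℂ) • tailSeq z) ?_ ?_).trans ?_
      · exact (zero_lt_one.trans_le (Fact.out : 1 ≤ p)).ne'
      · exact fun n => norm_weight_mul_le hpos hbdd z n
      · rw [norm_smul, Complex.norm_real, Real.norm_of_nonneg h2]
        gcongr
        exact norm_tailSeq_le z)

theorem backwardShift_apply [Fact (1 ≤ p)] (ω : ℕ → ℝ) (hpos : ∀ n, 0 < ω n)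
    (hbdd : BddAbove (Set.range ω)) (z : SeqSpace p) (n : ℕ) :
    backwardShift p ω hpos hbdd z n = (ω n : ℂ) * z (n + 1) := rfl

/-- `T e_0 = 0`. -/
theorem backwardShift_single_zero [Fact (1 ≤ p)] (ω : ℕ → ℝ) (hpos : ∀ n, 0 < ω n)
    (hbdd : BddAbove (Set.range ω)) :
    backwardShift p ω hpos hbdd (seqSingle p 0 1) = 0 := by
  ext n
  simp [backwardShift_apply, lp.single_apply]

/-- `T e_{n+1} = ω_n e_n`. -/
theorem backwardShift_single_succ [Fact (1 ≤ p)] (ω : ℕ → ℝ) (hpos : ∀ n, 0 < ω n)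
    (hbdd : BddAbove (Set.range ω)) (n : ℕ) :
    backwardShift p ω hpos hbdd (seqSingle p (n + 1) 1) = (ω n : ℂ) • seqSingle p n 1 := by
  ext m
  rcases eq_or_ne m n with rfl | h
  · change (ω m : ℂ) * seqSingle p (m + 1) 1 (m + 1) = ω m * seqSingle p m 1 m
    simp
  · change (ω m : ℂ) * seqSingle p (n + 1) 1 (m + 1) = ω n * seqSingle p n 1 m
    simp [lp.single_apply, h]

end Shift

/-- The `n`-th term `k_n (θ_{1,n} + i θ_{2,n}) e_n` of the random series. -/
noncomputable def seriesTerm (p : ℝ≥0∞) {Ω : Type*} (k : ℕ → ℝ) (θ : Fin 2 → ℕ → Ω → ℝ) (s : Ω)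
    (n : ℕ) : SeqSpace p :=
  seqSingle p n ((k n : ℂ) * ((θ 0 n s : ℂ) + Complex.I * (θ 1 n s : ℂ)))

/-- The random series `∑ k_n (θ_{1,n} + i θ_{2,n}) e_n`, with its sum taken in `ℓ^p(ℕ)`. -/
noncomputable def randomSeries (p : ℝ≥0∞) [Fact (1 ≤ p)] {Ω : Type*} (k : ℕ → ℝ)
    (θ : Fin 2 → ℕ → Ω → ℝ) (s : Ω) : SeqSpace p :=
  ∑' n, seriesTerm p k θ s n

/-! ### Lévy exponents of Lévy measures with a first moment -/

/-! Everything reduces to real linear functionals of the random series X. For such a functional L,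
L(X) is a weighted sum of i.i.d. infinitely divisible variables, with weights k_n L(e_n) and k_n L(i
e_n), so its log-characteristic function is the sum of the Lévy exponent ψ over these weights
(`logChar_randomSeries`). Since α < 1, the Lévy measure has a first moment, whence |ψ(t)| ≤ C|t|; as
also ∑ k_n < ∞, all series converge absolutely.

The shift T kills e_0 and sends k_{n+1} e_{n+1} to k_n e_n. The weights of L ∘ T^N are therefore
those of L delayed by N places and preceded by zeros. As ψ(0) = 0, the log-characteristic function
does not change, which is invariance (`IsShiftBy.measurePreserving`).

In a codifference the drift terms cancel: ψ(c-d) - ψ(c) - ψ(-d) = ∫ (e^{icx} - 1)(e^{-idx} - 1)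
Λ(dx). Interpolating |e^{iu} - 1| between 2 and |u| bounds this by the p-th absolute moment of Λ, a
Gamma integral, times |c|^{p/2} |d|^{p/2}. Summing over the weights, one family delayed by n,
produces ∑ k_l^{p/2} k_{l+n}^{p/2} (`IsShiftBy.norm_logChar_codifference_le`).

Mixing is read off from independence: T^n X depends only on the variables of index at least n, so it
is independent of any fixed finite set of indices once n is large, and a π-λ argument extends this
to all events (`tendsto_measureReal_inter_of_indep`). -/

theorem truncation_nonneg (x : ℝ) : 0 ≤ _root_.truncation x := by
  unfold _root_.truncation; split_ifs <;> positivity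

theorem truncation_le_one (x : ℝ) : _root_.truncation x ≤ 1 := by
  unfold _root_.truncation
  split_ifs with h
  · exact le_rfl
  · rw [div_le_one] <;> linarith

theorem measurable_truncation : Measurable _root_.truncation := by
  unfold _root_.truncation
  exact Measurable.ite (measurableSet_lt (by fun_prop) measurable_const) measurable_const
    (by fun_prop)

/-- The exponent `∫ (e^{itx} - 1 - i κ(x) t x) Λ(dx)` of the Lévy measure `Λ`. -/
noncomputable def levyExponent (Λ : Measure ℝ) (t : ℝ) : ℂ :=
  ∫ x : ℝ, (Complex.exp (Complex.I * t * x) - 1 - Complex.I * truncation x * t * x) ∂Λ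

theorem norm_exp_I_mul_sub_one_le (u : ℝ) : ‖Complex.exp (Complex.I * u) - 1‖ ≤ |u| := by
  simpa using Real.norm_exp_I_mul_ofReal_sub_one_le (x := u)

theorem norm_exp_I_mul_sub_one_le_two (u : ℝ) : ‖Complex.exp (Complex.I * u) - 1‖ ≤ 2 := by
  refine (norm_sub_le _ _).trans ?_
  rw [mul_comm, Complex.norm_exp_ofReal_mul_I]
  norm_num

/-- The exponential increment and the compensator are each at most |tx|. No cancellation near x = 0
is needed, because only Lévy measures with a finite first moment occur. -/
theorem norm_levyExponent_integrand_le (t x : ℝ) :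
    ‖Complex.exp (Complex.I * t * x) - 1 - Complex.I * truncation x * t * x‖
      ≤ 2 * |t| * |x| := by
  have h1 := norm_exp_I_mul_sub_one_le (t * x)
  have h2 : ‖Complex.I * truncation x * t * x‖ ≤ |t * x| := by
    simp only [norm_mul, Complex.norm_I, Complex.norm_real, Real.norm_eq_abs, abs_mul, one_mul]
    rw [abs_of_nonneg (truncation_nonneg x), mul_assoc]
    exact mul_le_of_le_one_left (by positivity) (truncation_le_one x)
  push_cast at h1
  rw [← mul_assoc] at h1
  refine (norm_sub_le _ _).trans ((add_le_add h1 h2).trans ?_)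
  rw [abs_mul]; linarith

theorem aestronglyMeasurable_levyExponent_integrand (Λ : Measure ℝ) (t : ℝ) :
    AEStronglyMeasurable (fun x : ℝ =>
      Complex.exp (Complex.I * t * x) - 1 - Complex.I * truncation x * t * x) Λ := by
  have := measurable_truncation
  exact Measurable.aestronglyMeasurable (by fun_prop)

section Exponent

variable {Λ : Measure ℝ}

theorem integrable_levyExponent_integrand (hΛ : Integrable (fun x => |x|) Λ) (t : ℝ) :
    Integrable (fun x : ℝ =>
      Complex.exp (Complex.I * t * x) - 1 - Complex.I * truncation x * t * x) Λ :=
  (hΛ.const_mul (2 * |t|)).mono' (aestronglyMeasurable_levyExponent_integrand Λ t)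
    (ae_of_all _ (norm_levyExponent_integrand_le t))

theorem norm_levyExponent_le (hΛ : Integrable (fun x => |x|) Λ) (t : ℝ) :
    ‖levyExponent Λ t‖ ≤ 2 * (∫ x, |x| ∂Λ) * |t| := by
  refine (norm_integral_le_of_norm_le (hΛ.const_mul (2 * |t|))
    (ae_of_all _ (norm_levyExponent_integrand_le t))).trans_eq ?_
  rw [integral_const_mul]; ring

theorem levyExponent_zero (Λ : Measure ℝ) : levyExponent Λ 0 = 0 := by
  simp [levyExponent]

theorem continuous_levyExponent (hΛ : Integrable (fun x => |x|) Λ) :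
    Continuous (levyExponent Λ) := by
  rw [continuous_iff_continuousAt]
  intro t₀
  refine continuousAt_of_dominated (bound := fun x => 2 * (|t₀| + 1) * |x|)
    (Eventually.of_forall fun t => aestronglyMeasurable_levyExponent_integrand Λ t) ?_
    (hΛ.const_mul _) (ae_of_all _ fun x => by fun_prop)
  filter_upwards [Metric.ball_mem_nhds t₀ one_pos] with t ht
  refine ae_of_all _ fun x => (norm_levyExponent_integrand_le t x).trans ?_
  have : |t| ≤ |t₀| + 1 := by
    rw [Metric.mem_ball, Real.dist_eq] at ht
    have := abs_sub_abs_le_abs_sub t t₀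
    linarith
  gcongr

/-- The compensators are linear in t and cancel; what remains is (ab - 1) - (a - 1) - (b - 1) = (a -
1)(b - 1). -/
theorem levyExponent_codifference (hΛ : Integrable (fun x => |x|) Λ) (c d : ℝ) :
    levyExponent Λ (c - d) - levyExponent Λ c - levyExponent Λ (-d) =
      ∫ x : ℝ, (Complex.exp (Complex.I * (c * x : ℝ)) - 1) *
        (Complex.exp (Complex.I * (-d * x : ℝ)) - 1) ∂Λ := by
  have h := integrable_levyExponent_integrand hΛ
  unfold levyExponent
  rw [← integral_sub (h _) (h _)]
  refine (integral_sub ((h (c - d)).sub (h c)) (h (-d))).symm.trans ?_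
  simp only [Pi.sub_apply]
  congr 1 with x
  have e : Complex.exp (Complex.I * (c - d : ℝ) * x) =
      Complex.exp (Complex.I * (c * x : ℝ)) * Complex.exp (Complex.I * (-d * x : ℝ)) := by
    rw [← Complex.exp_add]; push_cast; ring_nf
  have e1 : Complex.I * (c : ℂ) * x = Complex.I * (c * x : ℝ) := by push_cast; ring
  have e2 : Complex.I * ((-d : ℝ) : ℂ) * x = Complex.I * (-d * x : ℝ) := by push_cast; ring
  rw [e, e1, e2]
  push_cast
  ring

/-- Geometric interpolation between the bounds 2 and |u|. -/
theorem norm_exp_I_mul_sub_one_le_rpow (u : ℝ) {s : ℝ} (hs0 : 0 ≤ s) (hs1 : s ≤ 1) :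
    ‖Complex.exp (Complex.I * u) - 1‖ ≤ 2 ^ (1 - s) * |u| ^ s := by
  set a := ‖Complex.exp (Complex.I * u) - 1‖ with ha
  have h0 : 0 ≤ a := norm_nonneg _
  calc a = a ^ (1 - s) * a ^ s := by
        rw [← Real.rpow_add_of_nonneg h0 (by linarith) hs0]; simp
    _ ≤ 2 ^ (1 - s) * |u| ^ s :=
        mul_le_mul
          (Real.rpow_le_rpow h0 (norm_exp_I_mul_sub_one_le_two u) (by linarith))
          (Real.rpow_le_rpow h0 (norm_exp_I_mul_sub_one_le u) hs0) (by positivity) (by positivity)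

/-- The codifference bound for Lévy exponents. -/
theorem norm_levyExponent_codifference_le (hΛ : Integrable (fun x => |x|) Λ) {r : ℝ}
    (hr0 : 0 < r) (hr2 : r ≤ 2) (hΛr : Integrable (fun x => |x| ^ r) Λ) (c d : ℝ) :
    ‖levyExponent Λ (c - d) - levyExponent Λ c - levyExponent Λ (-d)‖ ≤
      2 ^ (2 - r) * (∫ x, |x| ^ r ∂Λ) * (|c| ^ (r / 2) * |d| ^ (r / 2)) := by
  rw [levyExponent_codifference hΛ]
  refine (norm_integral_le_of_norm_le
    (hΛr.const_mul (2 ^ (2 - r) * (|c| ^ (r / 2) * |d| ^ (r / 2)))) (ae_of_all _ fun x => ?_)).trans_eq ?_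
  · rw [norm_mul]
    -- Each factor is interpolated with s = r/2, so the two powers of |x| multiply to |x|^r and the
    -- two constants to 2^(2 - r).
    refine (mul_le_mul (norm_exp_I_mul_sub_one_le_rpow (c * x) (s := r / 2) (by linarith)
      (by linarith)) (norm_exp_I_mul_sub_one_le_rpow (-d * x) (s := r / 2) (by linarith)
      (by linarith)) (norm_nonneg _) (by positivity)).trans_eq ?_
    rw [abs_mul, abs_mul, abs_neg, Real.mul_rpow (abs_nonneg _) (abs_nonneg _),
      Real.mul_rpow (abs_nonneg _) (abs_nonneg _)]
    have e1 : (2 : ℝ) ^ (2 - r) = 2 ^ (1 - r / 2) * 2 ^ (1 - r / 2) := by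
      rw [← Real.rpow_add two_pos]; ring_nf
    have e2 : |x| ^ r = |x| ^ (r / 2) * |x| ^ (r / 2) := by
      rw [← Real.rpow_add_of_nonneg (abs_nonneg _) (by linarith) (by linarith)]; ring_nf
    rw [e1, e2]; ring
  · rw [integral_const_mul]; ring

/-- The compensator is purely imaginary, so -Re ψ(t) = ∫ (1 - cos tx) Λ(dx). -/
theorem neg_re_levyExponent_le (hΛ : Integrable (fun x => |x|) Λ)
    (hΛ2 : Integrable (fun x => |x| ^ (2 : ℝ)) Λ) (t : ℝ) :
    -(levyExponent Λ t).re ≤ (∫ x, |x| ^ (2 : ℝ) ∂Λ) * t ^ 2 := by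
  unfold levyExponent
  have h := integrable_levyExponent_integrand hΛ t
  have e := integral_re h
  simp only [RCLike.re_to_complex] at e
  rw [← e, ← integral_neg, ← integral_mul_const]
  refine integral_mono h.re.neg (hΛ2.mul_const _) fun x => ?_
  have : (Complex.exp (Complex.I * t * x) - 1 - Complex.I * truncation x * t * x).re
      = Real.cos (t * x) - 1 := by
    have e1 : Complex.I * (t : ℂ) * x = (t * x : ℝ) * Complex.I := by push_cast; ring
    have e2 : Complex.I * (truncation x : ℂ) * t * x =
      (truncation x * t * x : ℝ) * Complex.I := by push_cast; ring
    rw [e1, e2, Complex.sub_re, Complex.sub_re, Complex.exp_ofReal_mul_I_re,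
      Complex.re_ofReal_mul]
    simp
  simp only [this]
  have h1 := Real.one_sub_sq_div_two_le_cos (x := t * x)
  rw [Real.rpow_two, sq_abs]
  nlinarith [sq_nonneg (t * x)]

/-- A law whose characteristic function is the exponential of a Lévy exponent with finite second
moment has finite first moment. -/
theorem integrable_id_of_charFun_eq_exp_levyExponent {ν : Measure ℝ} [IsProbabilityMeasure ν]
    (hΛ : Integrable (fun x => |x|) Λ) (hΛ2 : Integrable (fun x => |x| ^ (2 : ℝ)) Λ)
    (hν : ∀ t, charFun ν t = Complex.exp (levyExponent Λ t)) : Integrable (fun x => x) ν := by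
  -- With w = ψ(1/n), the estimate 1 - Re e^w ≤ -Re w + |w|² for |w| ≤ 1 gives a bound of order
  -- 1/n², since -Re w ≤ V/n² and |w| ≤ 2M/n.
  obtain ⟨C, hC⟩ : ∃ C : ℝ, ∀ᶠ n : ℕ in atTop,
      (n : ℝ) ^ 2 * (1 - (charFun ν (1 / n : ℝ)).re) ≤ C := by
    set M := ∫ x, |x| ∂Λ with hM
    set V := ∫ x, |x| ^ (2 : ℝ) ∂Λ with hV
    refine ⟨V + (2 * M) ^ 2, ?_⟩
    have h1 : ∀ᶠ n : ℕ in atTop, ‖levyExponent Λ (1 / n : ℝ)‖ < 1 := by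
      have : Tendsto (fun n : ℕ => ‖levyExponent Λ (1 / n : ℝ)‖) atTop (𝓝 0) := by
        have := ((continuous_levyExponent hΛ).tendsto 0).comp
          (tendsto_const_div_atTop_nhds_zero_nat (1 : ℝ))
        simpa [levyExponent_zero] using this.norm
      exact this.eventually_lt_const one_pos
    filter_upwards [h1, eventually_gt_atTop 0] with n hn hn0
    have hn0' : (0 : ℝ) < n := by exact_mod_cast hn0
    rw [hν]
    set w := levyExponent Λ (1 / n : ℝ) with hw
    have a1 := Complex.norm_exp_sub_one_sub_id_le hn.le
    have a2 : -w.re ≤ V * (1 / n) ^ 2 := neg_re_levyExponent_le hΛ hΛ2 _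
    have a3 : ‖w‖ ≤ 2 * M * (1 / n) := by
      have := norm_levyExponent_le hΛ (1 / n : ℝ)
      rwa [abs_of_pos (by positivity)] at this
    have a4 := (abs_le.1 ((Complex.abs_re_le_norm (Complex.exp w - 1 - w)).trans a1)).1
    simp only [Complex.sub_re, Complex.one_re] at a4
    have a5 : ‖w‖ ^ 2 ≤ (2 * M * (1 / n)) ^ 2 := by gcongr
    calc (n : ℝ) ^ 2 * (1 - (Complex.exp w).re)
        ≤ (n : ℝ) ^ 2 * (V * (1 / n) ^ 2 + (2 * M * (1 / n)) ^ 2) := by gcongr; linarith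
      _ = V + (2 * M) ^ 2 := by field_simp
  -- This is n²(1 - cos(x/n)) in half-angle form: its ν-integral is the quantity bounded above, and
  -- it tends pointwise to x²/2, so Fatou's lemma yields a finite second moment.
  set f : ℕ → ℝ → ℝ := fun n x => 2 * (n * Real.sin (x / n / 2)) ^ 2 with hf
  have hfi : ∀ n, Integrable (f n) ν := fun n => by
    refine Integrable.of_bound (C := 2 * (n * 1) ^ 2)
      (Measurable.aestronglyMeasurable (by fun_prop)) (ae_of_all _ fun x => ?_)
    have e : f n x = 2 * (n * |Real.sin (x / n / 2)|) ^ 2 := by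
      simp only [hf, mul_pow, sq_abs]
    rw [Real.norm_of_nonneg (by positivity), e]
    gcongr
    exact Real.abs_sin_le_one _
  have hfint : ∀ n : ℕ, ∫ x, f n x ∂ν = (n : ℝ) ^ 2 * (1 - (charFun ν (1 / n : ℝ)).re) := by
    intro n
    have hi : Integrable (fun x : ℝ => Complex.exp ((1 / n : ℝ) * x * Complex.I)) ν := by
      refine Integrable.of_bound (C := 1) (Measurable.aestronglyMeasurable (by fun_prop))
        (ae_of_all _ fun x => ?_)
      rw [← Complex.ofReal_mul, Complex.norm_exp_ofReal_mul_I]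
    have e := integral_re hi
    simp only [RCLike.re_to_complex] at e
    rw [charFun_apply_real, ← e]
    have hi' := hi.re
    simp only [RCLike.re_to_complex] at hi'
    have hsub := integral_sub (integrable_const (μ := ν) (1 : ℝ)) hi'
    rw [integral_const, probReal_univ, one_smul] at hsub
    rw [← hsub, ← integral_const_mul]
    congr 1 with x
    rw [← Complex.ofReal_mul, Complex.exp_ofReal_mul_I_re, hf]
    have := Real.sin_sq_eq_half_sub (x / n / 2)
    rw [show 2 * (x / (n : ℝ) / 2) = 1 / n * x by ring] at this
    have h2 : 1 - Real.cos (1 / n * x) = 2 * Real.sin (x / n / 2) ^ 2 := by linarith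
    rw [h2]; ring
  have hlim : ∀ x, Tendsto (fun n : ℕ => f n x) atTop (𝓝 (x ^ 2 / 2)) := by
    intro x
    have h1 : Tendsto (fun n : ℕ => (n : ℝ) * Real.sin (x / n / 2)) atTop (𝓝 (x / 2)) := by
      have hd : HasDerivAt (fun y : ℝ => Real.sin (x / 2 * y)) (x / 2) 0 := by
        have := ((hasDerivAt_id (0 : ℝ)).const_mul (x / 2)).sin
        simpa using this
      have h2 := hd.tendsto_slope_zero_right
      have h3 : Tendsto (fun n : ℕ => ((n : ℝ))⁻¹) atTop (𝓝[>] 0) :=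
        tendsto_inv_atTop_nhdsGT_zero.comp tendsto_natCast_atTop_atTop
      refine (h2.comp h3).congr fun n => ?_
      simp only [Function.comp, zero_add, mul_zero, Real.sin_zero, sub_zero, smul_eq_mul, inv_inv]
      ring_nf
    have := (h1.pow 2).const_mul 2
    convert this using 2; ring
  have hsq : Integrable (fun x : ℝ => x ^ 2 / 2) ν := by
    refine ⟨Measurable.aestronglyMeasurable (by fun_prop), ?_⟩
    rw [HasFiniteIntegral]
    have e : ∀ x : ℝ, ‖x ^ 2 / 2‖ₑ = liminf (fun n : ℕ => ENNReal.ofReal (f n x)) atTop := by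
      intro x
      rw [Real.enorm_of_nonneg (by positivity)]
      exact ((ENNReal.continuous_ofReal.tendsto _).comp (hlim x)).liminf_eq.symm
    simp_rw [e]
    refine (lintegral_liminf_le fun n => by fun_prop).trans_lt ?_
    have hle : ∀ᶠ n : ℕ in atTop, ∫⁻ x, ENNReal.ofReal (f n x) ∂ν ≤ ENNReal.ofReal C := by
      filter_upwards [hC] with n hn
      rw [← ofReal_integral_eq_lintegral_ofReal (hfi n) (ae_of_all _ fun x => by positivity), hfint]
      exact ENNReal.ofReal_le_ofReal hn
    exact (liminf_le_of_frequently_le' hle.frequently).trans_lt ENNReal.ofReal_lt_top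
  refine ((hsq.const_mul 2).add (integrable_const 1)).mono' aestronglyMeasurable_id
    (ae_of_all _ fun x => ?_)
  simp only [Pi.add_apply, Real.norm_eq_abs]
  nlinarith [sq_nonneg (|x| - 1), sq_abs x]

end Exponent

/-! ### Moments of the tempered stable Lévy measure -/

section Moments

variable {α aNeg aPos lNeg lPos : ℝ}

theorem temperedStableDensity_nonneg (ham : 0 < aNeg) (hap : 0 < aPos) (x : ℝ) :
    0 ≤ temperedStableDensity α aNeg aPos lNeg lPos x := by
  unfold temperedStableDensity
  split_ifs <;> positivity

theorem measurable_temperedStableDensity :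
    Measurable (temperedStableDensity α aNeg aPos lNeg lPos) := by
  unfold temperedStableDensity
  exact Measurable.ite measurableSet_Iio (by fun_prop)
    (Measurable.ite measurableSet_Ioi (by fun_prop) measurable_const)

/-- The integrand is a multiple of x^(q-α-1) e^(-lx), a Gamma integral that converges at 0 because q
> α. -/
theorem integrableOn_temperedStableDensity_mul_rpow {a l q : ℝ} (hl : 0 < l) (hq : α < q) :
    IntegrableOn (fun x : ℝ => a * (Real.exp (-l * x) / x ^ (1 + α)) * x ^ q) (Set.Ioi 0) ∧
    ∫ x in Set.Ioi (0 : ℝ), a * (Real.exp (-l * x) / x ^ (1 + α)) * x ^ q =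
      a * l ^ (α - q) * Real.Gamma (q - α) := by
  have e : ∀ x ∈ Set.Ioi (0 : ℝ), a * (x ^ (q - α - 1) * Real.exp (-(l * x))) =
      a * (Real.exp (-l * x) / x ^ (1 + α)) * x ^ q := by
    intro x hx
    rw [show q - α - 1 = q - (1 + α) by ring, Real.rpow_sub hx, neg_mul]
    ring
  constructor
  · refine IntegrableOn.congr_fun ?_ e measurableSet_Ioi
    refine Integrable.const_mul ?_ a
    have := integrableOn_rpow_mul_exp_neg_mul_rpow (p := 1) (s := q - α - 1) (b := l)
      (by linarith) one_pos hl
    simpa [IntegrableOn] using this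
  · rw [← setIntegral_congr_fun measurableSet_Ioi e, integral_const_mul,
      Real.integral_rpow_mul_exp_neg_mul_Ioi (by linarith) hl, one_div, Real.inv_rpow hl.le,
      ← Real.rpow_neg hl.le]
    ring_nf

/-- Absolute moments of the tempered stable Lévy measure. -/
theorem integral_temperedStableLevy_abs_rpow (ham : 0 < aNeg) (hap : 0 < aPos) (hlm : 0 < lNeg)
    (hlp : 0 < lPos) {q : ℝ} (hq : α < q) :
    Integrable (fun x : ℝ => |x| ^ q) (temperedStableLevy α aNeg aPos lNeg lPos) ∧
    ∫ x, |x| ^ q ∂(temperedStableLevy α aNeg aPos lNeg lPos) =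
      (aNeg * lNeg ^ (α - q) + aPos * lPos ^ (α - q)) * Real.Gamma (q - α) := by
  have hP := integrableOn_temperedStableDensity_mul_rpow (a := aPos) hlp hq
  have hN := integrableOn_temperedStableDensity_mul_rpow (a := aNeg) hlm hq
  set D := temperedStableDensity α aNeg aPos lNeg lPos with hD
  have eP : ∀ x ∈ Set.Ioi (0 : ℝ), aPos * (Real.exp (-lPos * x) / x ^ (1 + α)) * x ^ q =
      D x * |x| ^ q := by
    intro x hx
    have hx' : 0 < x := hx
    simp [hD, temperedStableDensity, hx', hx'.not_gt, abs_of_pos hx']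
  have eN : ∀ x ∈ Set.Ioi (0 : ℝ), aNeg * (Real.exp (-lNeg * x) / x ^ (1 + α)) * x ^ q =
      D (-x) * |-x| ^ q := by
    intro x hx
    have hx' : 0 < x := hx
    simp [hD, temperedStableDensity, hx', abs_of_pos hx']
  have iP : IntegrableOn (fun x => D x * |x| ^ q) (Set.Ioi 0) :=
    hP.1.congr_fun eP measurableSet_Ioi
  have iN' : IntegrableOn (fun x => D (-x) * |-x| ^ q) (Set.Ioi 0) :=
    hN.1.congr_fun eN measurableSet_Ioi
  have iN : IntegrableOn (fun x => D x * |x| ^ q) (Set.Iic 0) := by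
    rw [integrableOn_Iic_iff_integrableOn_Iio]
    have := (Measure.measurePreserving_neg (volume : Measure ℝ)).integrableOn_comp_preimage
      (Homeomorph.neg ℝ).measurableEmbedding (f := fun x => D x * |x| ^ q) (s := Set.Iio 0)
    rw [← this]
    simpa [Function.comp_def] using iN'
  have itot : Integrable (fun x => D x * |x| ^ q) := by
    rw [← integrableOn_univ, ← Set.Iic_union_Ioi (a := (0 : ℝ))]
    exact iN.union iP
  have hmeas : Measurable fun x => ENNReal.ofReal (D x) :=
    measurable_temperedStableDensity.ennreal_ofReal
  have hsm : ∀ x : ℝ, (ENNReal.ofReal (D x)).toReal • |x| ^ q = D x * |x| ^ q := fun x => by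
    rw [ENNReal.toReal_ofReal (temperedStableDensity_nonneg ham hap x), smul_eq_mul]
  constructor
  · unfold temperedStableLevy
    rw [integrable_withDensity_iff_integrable_smul' hmeas (by simp)]
    simpa only [hsm] using itot
  · unfold temperedStableLevy
    rw [integral_withDensity_eq_integral_toReal_smul hmeas (by simp)]
    simp only [hsm]
    rw [← intervalIntegral.integral_Iic_add_Ioi iN iP, ← setIntegral_congr_fun measurableSet_Ioi eP,
      hP.2, ← neg_zero, ← integral_comp_neg_Ioi, ← setIntegral_congr_fun measurableSet_Ioi eN, hN.2]
    ring

end Moments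

/-! ### Characteristic functions of weighted sums of independent infinitely divisible variables -/

section WeightedSum

variable {Λ : Measure ℝ} {ι : Type*}

theorem summable_levyExponent (hΛ : Integrable (fun x => |x|) Λ) {c : ι → ℝ}
    (hc : Summable fun q => |c q|) : Summable fun q => levyExponent Λ (c q) :=
  Summable.of_norm_bounded (hc.mul_left _) fun q => norm_levyExponent_le hΛ (c q)

theorem continuous_tsum_levyExponent (hΛ : Integrable (fun x => |x|) Λ) {c : ι → ℝ}
    (hc : Summable fun q => |c q|) : Continuous fun t : ℝ => ∑' q, levyExponent Λ (t * c q) := by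
  rw [continuous_iff_continuousAt]
  intro t₀
  have h : ContinuousOn (fun t : ℝ => ∑' q, levyExponent Λ (t * c q)) (Metric.ball t₀ 1) := by
    refine continuousOn_tsum (u := fun q => 2 * (∫ x, |x| ∂Λ) * ((|t₀| + 1) * |c q|)) (fun q => ?_)
      ((hc.mul_left _).mul_left _) fun q t ht => ?_
    · exact ((continuous_levyExponent hΛ).comp (by fun_prop)).continuousOn
    · have h1 : |t| ≤ |t₀| + 1 := by
        rw [Metric.mem_ball, Real.dist_eq] at ht
        have := abs_sub_abs_le_abs_sub t t₀
        linarith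
      have h2 : 0 ≤ ∫ x, |x| ∂Λ := integral_nonneg fun x => abs_nonneg x
      refine (norm_levyExponent_le hΛ _).trans ?_
      rw [abs_mul]
      gcongr
  exact h.continuousAt (Metric.ball_mem_nhds t₀ one_pos)

variable {Ω : Type*} [MeasurableSpace Ω] {P : Measure Ω} {ξ : ι → Ω → ℝ}

theorem charFun_map_finsetSum_mul (hξ : ∀ q, Measurable (ξ q)) (hindep : iIndepFun ξ P)
    (hchar : ∀ q t, charFun (P.map (ξ q)) t = Complex.exp (levyExponent Λ t)) (c : ι → ℝ)
    (S : Finset ι) :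
    ∫ s, Complex.exp (Complex.I * ((∑ q ∈ S, c q * ξ q s : ℝ) : ℂ)) ∂P =
      Complex.exp (∑ q ∈ S, levyExponent Λ (c q)) := by
  have hm : ∀ q, Measurable fun s => c q * ξ q s := fun q => (hξ q).const_mul _
  have hsm : Measurable fun s => ∑ q ∈ S, c q * ξ q s :=
    Finset.measurable_fun_sum _ fun q _ => hm q
  have hind : iIndepFun (fun q s => c q * ξ q s) P :=
    hindep.comp (fun q x => c q * x) fun q => measurable_const_mul _
  have h := congrFun ((hind.restrict S).charFun_map_fun_finsetSum_eq_prod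
    (s := S) fun q _ => (hm q).aemeasurable) 1
  rw [charFun_apply_real, integral_map hsm.aemeasurable (by fun_prop), Finset.prod_apply] at h
  rw [Complex.exp_sum]
  convert h using 2 with s q q
  · push_cast; ring_nf
  · rw [charFun_map_mul_comp (hξ _).aemeasurable, mul_one, hchar]

theorem integral_exp_weightedSum [Countable ι] [IsProbabilityMeasure P]
    (hΛ : Integrable (fun x => |x|) Λ) (hξ : ∀ q, Measurable (ξ q))
    (hindep : iIndepFun ξ P)
    (hchar : ∀ q t, charFun (P.map (ξ q)) t = Complex.exp (levyExponent Λ t)) {c : ι → ℝ}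
    (hc : Summable fun q => |c q|) {Y : Ω → ℝ} (hY : ∀ᵐ s ∂P, HasSum (fun q => c q * ξ q s) (Y s)) :
    ∫ s, Complex.exp (Complex.I * (Y s : ℂ)) ∂P =
      Complex.exp (∑' q, levyExponent Λ (c q)) := by
  have h1 : Tendsto (fun S : Finset ι =>
      ∫ s, Complex.exp (Complex.I * ((∑ q ∈ S, c q * ξ q s : ℝ) : ℂ)) ∂P) atTop
      (𝓝 (∫ s, Complex.exp (Complex.I * (Y s : ℂ)) ∂P)) := by
    -- Dominated convergence along finite subsets is legitimate because ι is countable, which makes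
    -- `atTop` on `Finset ι` countably generated.
    refine tendsto_integral_filter_of_dominated_convergence (fun _ => 1)
      (Eventually.of_forall fun S => ?_) (Eventually.of_forall fun S => ae_of_all _ fun s => ?_)
      (integrable_const _) ?_
    · exact Measurable.aestronglyMeasurable (by fun_prop)
    · rw [mul_comm, Complex.norm_exp_ofReal_mul_I]
    · filter_upwards [hY] with s hs
      have hcont : Continuous fun y : ℝ => Complex.exp (Complex.I * (y : ℂ)) := by fun_prop
      exact (hcont.tendsto _).comp hs
  simp_rw [charFun_map_finsetSum_mul hξ hindep hchar c] at h1
  refine tendsto_nhds_unique h1 ?_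
  exact (Complex.continuous_exp.tendsto _).comp (summable_levyExponent hΛ hc).hasSum

end WeightedSum

/-! ### Almost sure absolute summability and double series -/

/-- By Tonelli the expected sum of |k_n ξ_n| is ∑ |k_n| times the common first absolute moment,
hence finite. -/
theorem ae_summable_mul_of_map_eq {Ω : Type*} [MeasurableSpace Ω] {P : Measure Ω}
    {ν : Measure ℝ} (hν : Integrable (fun x => x) ν) {ξ : ℕ → Ω → ℝ} (hξ : ∀ n, Measurable (ξ n))
    (hlaw : ∀ n, P.map (ξ n) = ν) {k : ℕ → ℝ} (hk : Summable fun n => |k n|) :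
    ∀ᵐ s ∂P, Summable fun n => |k n * ξ n s| := by
  have hne : ∫⁻ s, ∑' n, ‖k n * ξ n s‖ₑ ∂P ≠ ∞ := by
    rw [lintegral_tsum fun n => by fun_prop]
    have e : ∀ n, ∫⁻ s, ‖k n * ξ n s‖ₑ ∂P = ‖k n‖ₑ * ∫⁻ x, ‖x‖ₑ ∂ν := fun n => by
      simp_rw [enorm_mul]
      rw [lintegral_const_mul _ (by fun_prop), ← hlaw n, lintegral_map (by fun_prop) (hξ n)]
    simp_rw [e]
    rw [ENNReal.tsum_mul_right]
    refine ENNReal.mul_ne_top ?_ hν.2.ne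
    simp_rw [← ofReal_norm, Real.norm_eq_abs]
    exact hk.tsum_ofReal_ne_top
  filter_upwards [ae_lt_top' (by fun_prop) hne] with s hs
  have h := ENNReal.summable_toReal hs.ne
  simpa using h

theorem summable_fin_prod_of_norm {m : ℕ} {E : Type*} [NormedAddCommGroup E] [CompleteSpace E]
    {f : Fin m × ℕ → E} (hf : ∀ i, Summable fun n => ‖f (i, n)‖) : Summable fun q => ‖f q‖ :=
  (summable_prod_of_nonneg fun _ => norm_nonneg _).2 ⟨hf, Summable.of_finite⟩

theorem tsum_fin_prod_of_norm {m : ℕ} {E : Type*} [NormedAddCommGroup E] [CompleteSpace E]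
    {f : Fin m × ℕ → E} (hf : ∀ i, Summable fun n => ‖f (i, n)‖) :
    ∑' q, f q = ∑ i, ∑' n, f (i, n) := by
  rw [(summable_fin_prod_of_norm hf).of_norm.tsum_prod, tsum_fintype]

/-! ### The random series in `ℓ^p` -/

/-- Finitely supported sequences are dense. Separability is what allows a Borel law to be identified
by its characteristic functional. -/
theorem separableSpace_seqSpace {p : ℝ≥0∞} [Fact (1 ≤ p)] (hp : p ≠ ∞) :
    TopologicalSpace.SeparableSpace (SeqSpace p) := by
  let F : (N : ℕ) → (Fin N → ℂ) → SeqSpace p := fun N a => ∑ i : Fin N, seqSingle p i (a i)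
  have hF : ∀ N, Continuous (F N) := fun N =>
    continuous_finsetSum _ fun i _ => (lp.isometry_single (i : ℕ)).continuous.comp (continuous_apply i)
  have hsep : TopologicalSpace.IsSeparable (⋃ N, Set.range (F N)) :=
    .iUnion fun N => TopologicalSpace.isSeparable_range (hF N)
  rw [← TopologicalSpace.isSeparable_univ_iff]
  refine hsep.closure.mono fun z _ => ?_
  refine mem_closure_of_tendsto (lp.hasSum_single hp z).tendsto_sum_nat
    (Eventually.of_forall fun N => Set.mem_iUnion.2 ⟨N, fun i => z i, ?_⟩)
  exact Fin.sum_univ_eq_sum_range (fun i => seqSingle p i (z i)) N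

section Series

variable {p : ℝ≥0∞} {Ω : Type*} {k : ℕ → ℝ} {θ : Fin 2 → ℕ → Ω → ℝ}

/-- Splitting along e_n and i e_n turns X into a real series indexed by `Fin 2 × ℕ`, so that real
and imaginary parts of functionals are treated alike. -/
theorem seriesTerm_eq_sum (s : Ω) (n : ℕ) :
    seriesTerm p k θ s n =
      ∑ i : Fin 2, (k n * θ i n s : ℝ) • seqSingle p n (Complex.I ^ (i : ℕ)) := by
  have h : ∀ (r : ℝ) (c : ℂ), r • seqSingle p n c = seqSingle p n ((r : ℂ) * c) := fun r c => by
    rw [seqSingle, ← lp.single_smul, Complex.real_smul]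
  simp only [Fin.sum_univ_two, h, ← lp.single_add, seriesTerm]
  congr 1
  simp
  ring

variable [hp : Fact (1 ≤ p)]

theorem norm_seqSingle (n : ℕ) (c : ℂ) : ‖seqSingle p n c‖ = ‖c‖ := by
  have h : 0 < p := zero_lt_one.trans_le hp.out
  exact lp.norm_single (E := fun _ : ℕ => ℂ) h n c

theorem continuous_seqSingle (n : ℕ) : Continuous (seqSingle p n) :=
  (lp.isometry_single (E := fun _ : ℕ => ℂ) (p := p) n).continuous

theorem summable_norm_seriesTerm {s : Ω} (hs : ∀ i, Summable fun n => |k n * θ i n s|) :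
    Summable fun n => ‖seriesTerm p k θ s n‖ := by
  refine Summable.of_nonneg_of_le (fun _ => norm_nonneg _) (fun n => ?_) ((hs 0).add (hs 1))
  rw [seriesTerm_eq_sum]
  refine (norm_sum_le _ _).trans_eq ?_
  simp [norm_smul, norm_seqSingle]

theorem hasSum_randomSeries {s : Ω} (hs : ∀ i, Summable fun n => |k n * θ i n s|) :
    HasSum (seriesTerm p k θ s) (randomSeries p k θ s) := by
  have h : Summable (seriesTerm p k θ s) := (summable_norm_seriesTerm (p := p) hs).of_norm
  exact h.hasSum

/-- The coefficients of `θ_{i,n}` in `L (∑ k_n (θ_{0,n} + i θ_{1,n}) e_n)`. -/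
noncomputable def seriesCoeff (k : ℕ → ℝ) (L : StrongDual ℝ (SeqSpace p)) (q : Fin 2 × ℕ) : ℝ :=
  k q.2 * L (seqSingle p q.2 (Complex.I ^ (q.1 : ℕ)))

theorem abs_seriesCoeff_le (L : StrongDual ℝ (SeqSpace p)) (q : Fin 2 × ℕ) :
    |seriesCoeff k L q| ≤ |k q.2| * ‖L‖ := by
  rw [seriesCoeff, abs_mul]
  gcongr
  refine (L.le_opNorm _).trans_eq ?_
  simp [norm_seqSingle]

theorem summable_seriesCoeff (hk : Summable fun n => |k n|) (L : StrongDual ℝ (SeqSpace p)) :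
    Summable fun q => |seriesCoeff k L q| := by
  have h : ∀ i, Summable fun n => ‖seriesCoeff k L (i, n)‖ := fun i =>
    Summable.of_nonneg_of_le (fun _ => norm_nonneg _)
      (fun n => abs_seriesCoeff_le L (i, n)) (hk.mul_right ‖L‖)
  exact summable_fin_prod_of_norm (f := seriesCoeff k L) h

theorem hasSum_apply_randomSeries (L : StrongDual ℝ (SeqSpace p)) {s : Ω}
    (hs : ∀ i, Summable fun n => |k n * θ i n s|) :
    HasSum (fun q : Fin 2 × ℕ => seriesCoeff k L q * θ q.1 q.2 s) (L (randomSeries p k θ s)) := by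
  set f : Fin 2 × ℕ → ℝ := fun q => seriesCoeff k L q * θ q.1 q.2 s with hf
  have hn : ∀ i, Summable fun n => ‖f (i, n)‖ := fun i => by
    refine Summable.of_nonneg_of_le (fun _ => norm_nonneg _) (fun n => ?_) ((hs i).mul_right ‖L‖)
    simp only [hf]
    rw [norm_mul, abs_mul, mul_right_comm]
    exact mul_le_mul_of_nonneg_right (abs_seriesCoeff_le L (i, n)) (abs_nonneg _)
  have h1 := (hasSum_randomSeries (p := p) hs).mapL L
  have h2 : HasSum (fun n => ∑ i, f (i, n)) (∑ i, ∑' n, f (i, n)) :=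
    hasSum_sum fun i _ => (hn i).of_norm.hasSum
  have h3 : (fun n => L (seriesTerm p k θ s n)) =
      fun n => ∑ i, f (i, n) := by
    ext n
    rw [seriesTerm_eq_sum, map_sum]
    refine Finset.sum_congr rfl fun i _ => ?_
    rw [map_smul, smul_eq_mul, hf]
    simp only [seriesCoeff]
    ring
  rw [h3] at h1
  rw [h1.unique h2, ← tsum_fin_prod_of_norm (f := f) hn]
  exact (summable_fin_prod_of_norm (f := f) hn).of_norm.hasSum

/-- If every term of `S (∑ k_n (θ_{0,n} + i θ_{1,n}) e_n)` either vanishes or is measurable with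
respect to a sub-σ-algebra, then so is the sum up to a null set. -/
theorem aestronglyMeasurable_clm_randomSeries (m : MeasurableSpace Ω) {m0 : MeasurableSpace Ω}
    {P : Measure Ω} (hs : ∀ᵐ s ∂P, ∀ i, Summable fun n => |k n * θ i n s|)
    (S : SeqSpace p →L[ℂ] SeqSpace p)
    (hS : ∀ n, (∀ c, S (seqSingle p n c) = 0) ∨ ∀ i, Measurable[m] (θ i n)) :
    AEStronglyMeasurable[m] (fun s => S (randomSeries p k θ s)) P := by
  have hterm : ∀ n, StronglyMeasurable[m] fun s => S (seriesTerm p k θ s n) := by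
    intro n
    rcases hS n with h | h
    · simp only [seriesTerm, h]
      exact stronglyMeasurable_const
    · have hc : Continuous fun c : ℂ => S (seqSingle p n c) :=
        S.continuous.comp (continuous_seqSingle n)
      refine hc.comp_stronglyMeasurable (Measurable.stronglyMeasurable ?_)
      have h0 := h 0
      have h1 := h 1
      fun_prop
  have hsum : ∀ N, StronglyMeasurable[m] fun s =>
      ∑ n ∈ Finset.range N, S (seriesTerm p k θ s n) := fun N =>
    Finset.stronglyMeasurable_fun_sum _ fun n _ => hterm n
  -- `limUnder` of the partial sums is measurable everywhere; it equals the sum wherever the series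
  -- converges, hence almost everywhere.
  refine ⟨_, @StronglyMeasurable.limUnder _ _ _ m _ _ atTop _ _ _ _ hsum, ?_⟩
  filter_upwards [hs] with s hs
  exact ((hasSum_randomSeries (p := p) hs).mapL S).tendsto_sum_nat.limUnder_eq.symm

end Series

/-! ### Asymptotic independence of the tail -/

/-- If the events `B n` have constant probability and `B n` is independent of the `N`-th σ-algebra
of an increasing sequence as soon as `N ≤ n`, then `B n` is asymptotically independent of every
event of the limit σ-algebra. -/
theorem tendsto_measureReal_inter_of_indep {Ω : Type*} {m0 : MeasurableSpace Ω} {P : Measure Ω}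
    [IsProbabilityMeasure P] {F : ℕ → MeasurableSpace Ω} (hF : Monotone F) (hF0 : ∀ N, F N ≤ m0)
    {B : ℕ → Set Ω} (hB : ∀ n, MeasurableSet (B n)) {β : ℝ} (hβ : ∀ n, P.real (B n) = β)
    (hind : ∀ N n, N ≤ n → ∀ S, MeasurableSet[F N] S →
      P.real (S ∩ B n) = P.real S * P.real (B n))
    {S : Set Ω} (hS : MeasurableSet[⨆ N, F N] S) :
    Tendsto (fun n => P.real (S ∩ B n)) atTop (𝓝 (P.real S * β)) := by
  have hle : (⨆ N, F N) ≤ m0 := iSup_le hF0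
  -- Dynkin induction from the π-system ⋃ F N, on whose members the sequence is eventually constant.
  refine MeasurableSpace.induction_on_inter (m := ⨆ N, F N)
    (C := fun S _ => Tendsto (fun n => P.real (S ∩ B n)) atTop (𝓝 (P.real S * β)))
    (MeasurableSpace.generateFrom_iUnion_measurableSet F).symm
    (isPiSystem_iUnion_of_monotone _ (fun N => @MeasurableSpace.isPiSystem_measurableSet _ (F N))
      fun _ _ h => hF h) ?_ ?_ ?_ ?_ S hS
  · simp
  · intro t ht
    obtain ⟨N, hN⟩ := Set.mem_iUnion.1 ht
    refine tendsto_const_nhds.congr' ?_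
    filter_upwards [eventually_ge_atTop N] with n hn
    rw [hind N n hn t hN, hβ]
  · intro t ht h
    have e : ∀ n, P.real (tᶜ ∩ B n) = β - P.real (t ∩ B n) := fun n => by
      rw [← hβ n, ← measureReal_inter_add_sdiff (s := B n) (hle t ht), Set.inter_comm (B n) t,
        add_sub_cancel_left, Set.inter_comm, ← Set.sdiff_eq]
    simp_rw [e, probReal_compl_eq_one_sub (hle t ht), sub_mul, one_mul]
    exact h.const_sub β
  · intro f hd hf h
    have hsum : Summable fun i => P.real (f i) := by
      have := measure_iUnion (μ := P) hd fun i => hle _ (hf i)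
      exact ENNReal.summable_toReal (this ▸ measure_ne_top P _)
    have e1 : ∀ n, P.real ((⋃ i, f i) ∩ B n) = ∑' i, P.real (f i ∩ B n) := fun n => by
      rw [Set.iUnion_inter, measureReal_def, measure_iUnion, ENNReal.tsum_toReal_eq]
      · rfl
      · exact fun i => measure_ne_top P _
      · exact fun i j hij => (hd hij).mono Set.inter_subset_left Set.inter_subset_left
      · exact fun i => (hle _ (hf i)).inter (hB n)
    have e2 : P.real (⋃ i, f i) = ∑' i, P.real (f i) := by
      rw [measureReal_def, measure_iUnion hd fun i => hle _ (hf i), ENNReal.tsum_toReal_eq]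
      · rfl
      · exact fun i => measure_ne_top P _
    simp_rw [e1, e2, ← tsum_mul_right]
    -- The terms are dominated by P(f i), uniformly in n.
    refine tendsto_tsum_of_dominated_convergence hsum h (Eventually.of_forall fun n i => ?_)
    rw [Real.norm_of_nonneg measureReal_nonneg]
    exact measureReal_mono Set.inter_subset_left

/-! ### The law of the random series -/

section Law

variable {Λ : Measure ℝ} {p : ℝ≥0∞} [Fact (1 ≤ p)] {Ω : Type*} [MeasurableSpace Ω]
  {P : Measure Ω} {k : ℕ → ℝ} {θ : Fin 2 → ℕ → Ω → ℝ}

theorem ae_summable_mul [IsProbabilityMeasure P] (hΛ : Integrable (fun x => |x|) Λ)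
    (hΛ2 : Integrable (fun x => |x| ^ (2 : ℝ)) Λ) (hk : Summable fun n => |k n|)
    (hθ : ∀ i n, Measurable (θ i n))
    (hchar : ∀ i n t, charFun (P.map (θ i n)) t = Complex.exp (levyExponent Λ t)) :
    ∀ᵐ s ∂P, ∀ i, Summable fun n => |k n * θ i n s| := by
  have hprob : ∀ i n, IsProbabilityMeasure (P.map (θ i n)) := fun i n =>
    Measure.isProbabilityMeasure_map (hθ i n).aemeasurable
  refine ae_all_iff.2 fun i => ae_summable_mul_of_map_eq (ν := P.map (θ i 0))
    (integrable_id_of_charFun_eq_exp_levyExponent hΛ hΛ2 (hchar i 0)) (hθ i) (fun n => ?_) hk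
  exact Measure.ext_of_charFun (funext fun t => by rw [hchar, hchar])

variable [MeasurableSpace (SeqSpace p)] [BorelSpace (SeqSpace p)]

theorem aemeasurable_randomSeries (hθ : ∀ i n, Measurable (θ i n))
    (hs : ∀ᵐ s ∂P, ∀ i, Summable fun n => |k n * θ i n s|) :
    AEMeasurable (randomSeries p k θ) P :=
  (aestronglyMeasurable_clm_randomSeries _ hs (.id ℂ _)
    fun n => .inr fun i => hθ i n).aemeasurable

theorem charPath_map_randomSeries [IsProbabilityMeasure P]
    (hΛ : Integrable (fun x => |x|) Λ)
    (hk : Summable fun n => |k n|) (hθ : ∀ i n, Measurable (θ i n))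
    (hindep : iIndepFun (fun q : Fin 2 × ℕ => θ q.1 q.2) P)
    (hchar : ∀ i n t, charFun (P.map (θ i n)) t = Complex.exp (levyExponent Λ t))
    (hs : ∀ᵐ s ∂P, ∀ i, Summable fun n => |k n * θ i n s|)
    (L : StrongDual ℝ (SeqSpace p)) (t : ℝ) :
    charPath (P.map (randomSeries p k θ)) L t =
      Complex.exp (∑' q, levyExponent Λ (t * seriesCoeff k L q)) := by
  have hL : Measurable L := L.continuous.measurable
  rw [charPath, integral_map (aemeasurable_randomSeries hθ hs)
    (Measurable.aestronglyMeasurable (by fun_prop))]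
  refine integral_exp_weightedSum hΛ (fun q => hθ q.1 q.2) hindep (fun q => hchar q.1 q.2)
    (c := fun q => t * seriesCoeff k L q) ?_ ?_
  · simp_rw [abs_mul]
    exact (summable_seriesCoeff hk L).mul_left _
  · filter_upwards [hs] with s hs
    simpa only [mul_assoc] using (hasSum_apply_randomSeries L hs).mul_left t

/-- The series of exponents is continuous in t and vanishes at 0, so it is itself the distinguished
logarithm; in particular the characteristic function has no zero. -/
theorem isLogBranch_randomSeries [IsProbabilityMeasure P]
    (hΛ : Integrable (fun x => |x|) Λ)
    (hk : Summable fun n => |k n|) (hθ : ∀ i n, Measurable (θ i n))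
    (hindep : iIndepFun (fun q : Fin 2 × ℕ => θ q.1 q.2) P)
    (hchar : ∀ i n t, charFun (P.map (θ i n)) t = Complex.exp (levyExponent Λ t))
    (hs : ∀ᵐ s ∂P, ∀ i, Summable fun n => |k n * θ i n s|) (L : StrongDual ℝ (SeqSpace p)) :
    IsLogBranch (charPath (P.map (randomSeries p k θ)) L)
      fun t => ∑' q, levyExponent Λ (t * seriesCoeff k L q) :=
  ⟨continuous_tsum_levyExponent hΛ (summable_seriesCoeff hk L), by simp [levyExponent_zero],
    fun t => (charPath_map_randomSeries hΛ hk hθ hindep hchar hs L t).symm⟩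

theorem logChar_randomSeries [IsProbabilityMeasure P]
    (hΛ : Integrable (fun x => |x|) Λ)
    (hk : Summable fun n => |k n|) (hθ : ∀ i n, Measurable (θ i n))
    (hindep : iIndepFun (fun q : Fin 2 × ℕ => θ q.1 q.2) P)
    (hchar : ∀ i n t, charFun (P.map (θ i n)) t = Complex.exp (levyExponent Λ t))
    (hs : ∀ᵐ s ∂P, ∀ i, Summable fun n => |k n * θ i n s|) (L : StrongDual ℝ (SeqSpace p)) :
    logChar (P.map (randomSeries p k θ)) L = ∑' q, levyExponent Λ (seriesCoeff k L q) := by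
  rw [(isLogBranch_randomSeries hΛ hk hθ hindep hchar hs L).logChar_eq]
  simp

end Law

/-! ### Operators shifting the random series -/

section ShiftBy

variable {p : ℝ≥0∞} [Fact (1 ≤ p)]

/-- `S` kills `e_0, …, e_{N-1}` and maps `k_{n+N} e_{n+N}` to `k_n e_n`. -/
structure IsShiftBy (k : ℕ → ℝ) (N : ℕ) (S : SeqSpace p →L[ℂ] SeqSpace p) : Prop where
  map_single_of_lt : ∀ n < N, ∀ c, S (seqSingle p n c) = 0
  map_single_add : ∀ n c, (k (n + N) : ℂ) • S (seqSingle p (n + N) c) = (k n : ℂ) • seqSingle p n c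

theorem IsShiftBy.pow {k : ℕ → ℝ} (hk : ∀ n, k n ≠ 0) {T : SeqSpace p →L[ℂ] SeqSpace p}
    (hT : IsShiftBy k 1 T) (N : ℕ) : IsShiftBy k N (T ^ N) := by
  induction N with
  | zero => exact ⟨fun n hn => absurd hn (by simp), fun n c => by simp⟩
  | succ N ih =>
    have hz : ∀ c, T (seqSingle p 0 c) = 0 := hT.map_single_of_lt 0 one_pos
    refine ⟨fun n hn c => ?_, fun n c => ?_⟩ <;> rw [pow_succ', mul_apply_eq_comp]
    · rcases Nat.lt_succ_iff_lt_or_eq.1 hn with h | rfl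
      · rw [ih.map_single_of_lt n h, map_zero]
      -- Here n = N: T^N sends k_N e_N to k_0 e_0, which T kills, and k_N ≠ 0 can be divided out.
      · have h := congrArg T (ih.map_single_add 0 c)
        rw [zero_add, map_smul, map_smul, hz, smul_zero] at h
        exact (smul_eq_zero.1 h).resolve_left (by exact_mod_cast hk n)
    · have h := congrArg T (ih.map_single_add (n + 1) c)
      rw [map_smul, map_smul, hT.map_single_add, add_right_comm] at h
      exact h

variable {k : ℕ → ℝ} {N : ℕ} {S : SeqSpace p →L[ℂ] SeqSpace p}

theorem IsShiftBy.seriesCoeff_of_lt (hS : IsShiftBy k N S) (L : StrongDual ℝ (SeqSpace p))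
    (i : Fin 2) {n : ℕ} (hn : n < N) : seriesCoeff k (L.comp (S.restrictScalars ℝ)) (i, n) = 0 := by
  simp [seriesCoeff, hS.map_single_of_lt n hn]

theorem IsShiftBy.seriesCoeff_add (hS : IsShiftBy k N S) (L : StrongDual ℝ (SeqSpace p))
    (i : Fin 2) (n : ℕ) :
    seriesCoeff k (L.comp (S.restrictScalars ℝ)) (i, n + N) = seriesCoeff k L (i, n) := by
  have h := congrArg L (hS.map_single_add n (Complex.I ^ (i : ℕ)))
  rw [Complex.coe_smul, Complex.coe_smul, map_smul, map_smul] at h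
  exact h

theorem tsum_fin_prod_eq_sum_tsum_nat_add {m : ℕ} {f : Fin m × ℕ → ℂ}
    (hf : Summable fun q => ‖f q‖) (hN : ∀ i, ∀ n < N, f (i, n) = 0) :
    ∑' q, f q = ∑ i, ∑' n, f (i, n + N) := by
  have h : ∀ i, Summable fun n => ‖f (i, n)‖ := fun i => hf.prod_factor i
  rw [tsum_fin_prod_of_norm h]
  refine Finset.sum_congr rfl fun i _ => ?_
  have hi : Summable fun n => f (i, n) := (h i).of_norm
  rw [← hi.sum_add_tsum_nat_add N, Finset.sum_eq_zero, zero_add]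
  exact fun n hn => hN i n (Finset.mem_range.1 hn)

theorem IsShiftBy.tsum_levyExponent (hS : IsShiftBy k N S) {Λ : Measure ℝ}
    (hΛ : Integrable (fun x => |x|) Λ) (hk : Summable fun n => |k n|)
    (L : StrongDual ℝ (SeqSpace p)) :
    ∑' q, levyExponent Λ (seriesCoeff k (L.comp (S.restrictScalars ℝ)) q) =
      ∑' q, levyExponent Λ (seriesCoeff k L q) := by
  have h := fun L : StrongDual ℝ (SeqSpace p) =>
    (summable_levyExponent hΛ (summable_seriesCoeff hk L)).norm
  rw [tsum_fin_prod_eq_sum_tsum_nat_add (h _) (N := N) fun i n hn => by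
      rw [hS.seriesCoeff_of_lt L i hn, levyExponent_zero],
    -- With `N := 0` the right-hand side takes the same iterated form.
    tsum_fin_prod_eq_sum_tsum_nat_add (h L) (N := 0) fun i n hn => absurd hn (by simp)]
  simp_rw [hS.seriesCoeff_add, add_zero]

variable {Λ : Measure ℝ} {Ω : Type*} [MeasurableSpace Ω]
  {P : Measure Ω} [IsProbabilityMeasure P] {θ : Fin 2 → ℕ → Ω → ℝ}
  [MeasurableSpace (SeqSpace p)] [BorelSpace (SeqSpace p)]

/-- The law and its image have the same characteristic functional, since delaying the weights leaves
the sum of exponents unchanged. -/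
theorem IsShiftBy.measurePreserving (hS : IsShiftBy k N S) (hp : p ≠ ∞)
    (hΛ : Integrable (fun x => |x|) Λ) (hk : Summable fun n => |k n|)
    (hθ : ∀ i n, Measurable (θ i n))
    (hindep : iIndepFun (fun q : Fin 2 × ℕ => θ q.1 q.2) P)
    (hchar : ∀ i n t, charFun (P.map (θ i n)) t = Complex.exp (levyExponent Λ t))
    (hs : ∀ᵐ s ∂P, ∀ i, Summable fun n => |k n * θ i n s|) :
    MeasurePreserving S (P.map (randomSeries p k θ)) (P.map (randomSeries p k θ)) := by
  have : TopologicalSpace.SeparableSpace (SeqSpace p) := separableSpace_seqSpace hp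
  have : SecondCountableTopology (SeqSpace p) := UniformSpace.secondCountable_of_separable _
  have : IsProbabilityMeasure (P.map (randomSeries p k θ)) :=
    Measure.isProbabilityMeasure_map (aemeasurable_randomSeries hθ hs)
  have hSm : Measurable S := S.continuous.measurable
  have hdual : ∀ L : StrongDual ℝ (SeqSpace p), charFunDual (P.map (randomSeries p k θ)) L =
      Complex.exp (∑' q, levyExponent Λ (seriesCoeff k L q)) := fun L => by
    have h := charPath_map_randomSeries hΛ hk hθ hindep hchar hs L 1
    simp only [charPath, one_mul] at h
    rw [charFunDual_apply, ← h]
    simp_rw [mul_comm Complex.I]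
  refine ⟨hSm, ?_⟩
  have : IsProbabilityMeasure ((P.map (randomSeries p k θ)).map S) :=
    Measure.isProbabilityMeasure_map hSm.aemeasurable
  refine Measure.ext_of_charFunDual (funext fun L => ?_)
  have hLm : Measurable L := L.continuous.measurable
  have e : charFunDual ((P.map (randomSeries p k θ)).map S) L =
      charFunDual (P.map (randomSeries p k θ)) (L.comp (S.restrictScalars ℝ)) := by
    rw [charFunDual_apply, integral_map hSm.aemeasurable
      (Measurable.aestronglyMeasurable (by fun_prop)), charFunDual_apply]
    rfl
  rw [e, hdual, hdual, hS.tsum_levyExponent hΛ hk]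

/-- F N is generated by the variables of index below N and G n by those of index at least n. Since
T^n kills e_0, …, e_{n-1}, T^n X has a G n-measurable version, independent of F N for N ≤ n, while X
has a version measurable for the supremum of the F N. -/
theorem isStronglyMixing_randomSeries {T : SeqSpace p →L[ℂ] SeqSpace p}
    (hT : ∀ n, ∀ j < n, ∀ c, (T ^ n) (seqSingle p j c) = 0)
    (hTμ : MeasurePreserving T (P.map (randomSeries p k θ)) (P.map (randomSeries p k θ)))
    (hθ : ∀ i n, Measurable (θ i n))
    (hindep : iIndepFun (fun q : Fin 2 × ℕ => θ q.1 q.2) P)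
    (hs : ∀ᵐ s ∂P, ∀ i, Summable fun n => |k n * θ i n s|) :
    IsStronglyMixing T (P.map (randomSeries p k θ)) := by
  refine ⟨hTμ, fun A B hA hB => ?_⟩
  set X : Ω → SeqSpace p := randomSeries p k θ with hX
  have hXm : AEMeasurable X P := aemeasurable_randomSeries hθ hs
  have hprob : IsProbabilityMeasure (P.map X) := Measure.isProbabilityMeasure_map hXm
  let m : Fin 2 × ℕ → MeasurableSpace Ω := fun q => MeasurableSpace.comap (θ q.1 q.2) inferInstance
  have hm : ∀ q, m q ≤ ‹MeasurableSpace Ω› := fun q => (hθ q.1 q.2).comap_le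
  have hθm : ∀ i n, Measurable[m (i, n)] (θ i n) := fun i n => comap_measurable _
  let F : ℕ → MeasurableSpace Ω := fun N => ⨆ q ∈ {q : Fin 2 × ℕ | q.2 < N}, m q
  let G : ℕ → MeasurableSpace Ω := fun N => ⨆ q ∈ {q : Fin 2 × ℕ | N ≤ q.2}, m q
  have hF0 : ∀ N, F N ≤ ‹MeasurableSpace Ω› := fun N => iSup₂_le fun q _ => hm q
  have hG0 : ∀ N, G N ≤ ‹MeasurableSpace Ω› := fun N => iSup₂_le fun q _ => hm q
  have hFmono : Monotone F := fun M N h => biSup_mono fun q (hq : q.2 < M) => hq.trans_le h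
  have hFG : ∀ N n, N ≤ n → Indep (F N) (G n) P := fun N n h =>
    indep_iSup_of_disjoint hm hindep.iIndep
      (Set.disjoint_left.2 fun q (h1 : q.2 < N) (h2 : n ≤ q.2) => by omega)
  obtain ⟨X', hX'm, hX'⟩ : AEStronglyMeasurable[⨆ N, F N] X P :=
    aestronglyMeasurable_clm_randomSeries (⨆ N, F N) hs (.id ℂ _) fun n => .inr fun i =>
      (hθm i n).mono ((le_biSup m (show (i, n) ∈ {q : Fin 2 × ℕ | q.2 < n + 1} from
        Nat.lt_succ_self n)).trans (le_iSup F (n + 1))) le_rfl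
  have hZ : ∀ n, AEStronglyMeasurable[G n] (fun s => (T ^ n) (X s)) P := fun n =>
    aestronglyMeasurable_clm_randomSeries (G n) hs (T ^ n) fun j => by
      rcases lt_or_ge j n with h | h
      · exact .inl (hT n j h)
      · exact .inr fun i => (hθm i j).mono
          (le_biSup m (show (i, j) ∈ {q : Fin 2 × ℕ | n ≤ q.2} from h)) le_rfl
  choose Z hZm hZ using hZ
  have hcoe : ∀ n, ⇑(T ^ n) = T^[n] := fun n => by
    induction n with
    | zero => rfl
    | succ n ih => rw [pow_succ', Function.iterate_succ', ← ih]; rfl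
  have hTn : ∀ n, MeasurePreserving (T ^ n : SeqSpace p →L[ℂ] SeqSpace p) (P.map X) (P.map X) :=
    fun n => by
      rw [hcoe]
      exact hTμ.iterate n
  -- Invariance makes the probability of T^n X ∈ B the same for all n.
  have hZB : ∀ n, P.real (Z n ⁻¹' B) = (P.map X).real B := fun n => by
    rw [← (hTn n).measureReal_preimage hB.nullMeasurableSet,
      map_measureReal_apply_of_aemeasurable hXm ((hTn n).measurable hB)]
    refine measureReal_congr ?_
    filter_upwards [hZ n] with s hs
    exact congrArg (· ∈ B) hs.symm
  have key := tendsto_measureReal_inter_of_indep (P := P) hFmono hF0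
    (B := fun n => Z n ⁻¹' B) (fun n => hG0 n _ ((hZm n).measurable hB)) hZB
    (fun N n h S hS => by
      have := (Indep_iff _ _ _).1 (hFG N n h) S _ hS ((hZm n).measurable hB)
      simp only [measureReal_def, this, ENNReal.toReal_mul])
    (hX'm.measurable hA)
  have e1 : P.real (X' ⁻¹' A) = (P.map X).real A := by
    rw [map_measureReal_apply_of_aemeasurable hXm hA]
    refine measureReal_congr ?_
    filter_upwards [hX'] with s hs
    exact congrArg (· ∈ A) hs.symm
  have e2 : ∀ n, P.real (X' ⁻¹' A ∩ Z n ⁻¹' B) = (P.map X).real (A ∩ T^[n] ⁻¹' B) := fun n => by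
    rw [← hcoe,
      map_measureReal_apply_of_aemeasurable hXm (hA.inter ((hTn n).measurable hB))]
    refine measureReal_congr ?_
    filter_upwards [hX', hZ n] with s h1 h2
    exact congrArg₂ (fun a b => a ∈ A ∧ b ∈ B) h1.symm h2.symm
  rw [e1] at key
  simp_rw [e2] at key
  rw [← ENNReal.tendsto_toReal_iff (fun n => measure_ne_top _ _)
    (ENNReal.mul_ne_top (measure_ne_top _ _) (measure_ne_top _ _)), ENNReal.toReal_mul]
  exact key

/-- Stated for arbitrary real functionals L and M, it covers both codifferences. The constant 2^(3 -
r) is 2^(2 - r) doubled by the two values of `Fin 2`. -/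
theorem IsShiftBy.norm_logChar_codifference_le (hS : IsShiftBy k N S)
    (hΛ : Integrable (fun x => |x|) Λ) (hk : Summable fun n => |k n|) (hk0 : ∀ n, 0 ≤ k n)
    (hθ : ∀ i n, Measurable (θ i n))
    (hindep : iIndepFun (fun q : Fin 2 × ℕ => θ q.1 q.2) P)
    (hchar : ∀ i n t, charFun (P.map (θ i n)) t = Complex.exp (levyExponent Λ t))
    (hs : ∀ᵐ s ∂P, ∀ i, Summable fun n => |k n * θ i n s|)
    {r : ℝ} (hr0 : 0 < r) (hr2 : r ≤ 2) (hΛr : Integrable (fun x => |x| ^ r) Λ)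
    (hkr : Summable fun l => k l ^ (r / 2) * k (l + N) ^ (r / 2))
    (L M : StrongDual ℝ (SeqSpace p)) :
    ‖logChar (P.map (randomSeries p k θ))
          ⇑(L - M.comp (S.restrictScalars ℝ) : StrongDual ℝ (SeqSpace p))
        - logChar (P.map (randomSeries p k θ)) L
        - logChar (P.map (randomSeries p k θ))
          ⇑(-(M.comp (S.restrictScalars ℝ)) : StrongDual ℝ (SeqSpace p))‖ ≤
      2 ^ (3 - r) * (∫ x, |x| ^ r ∂Λ) * (‖L‖ ^ (r / 2) * ‖M‖ ^ (r / 2)) *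
        ∑' l, k l ^ (r / 2) * k (l + N) ^ (r / 2) := by
  set M' : StrongDual ℝ (SeqSpace p) := M.comp (S.restrictScalars ℝ) with hM'
  set K := 2 ^ (2 - r) * (∫ x, |x| ^ r ∂Λ) with hK
  have hsum := fun L : StrongDual ℝ (SeqSpace p) =>
    (summable_levyExponent hΛ (summable_seriesCoeff hk L))
  let D : Fin 2 × ℕ → ℂ := fun q => levyExponent Λ (seriesCoeff k L q - seriesCoeff k M' q) -
    levyExponent Λ (seriesCoeff k L q) - levyExponent Λ (-seriesCoeff k M' q)
  have hcsub : ∀ q, seriesCoeff k (L - M') q = seriesCoeff k L q - seriesCoeff k M' q := fun q => by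
    simp [seriesCoeff, mul_sub]
  have hcneg : ∀ q, seriesCoeff k (-M') q = -seriesCoeff k M' q := fun q => by
    simp [seriesCoeff]
  have hDeq : D = fun q => levyExponent Λ (seriesCoeff k (L - M') q) -
      levyExponent Λ (seriesCoeff k L q) - levyExponent Λ (seriesCoeff k (-M') q) :=
    funext fun q => by simp only [D, hcsub, hcneg]
  have hDs : Summable D := by
    rw [hDeq]
    exact ((hsum _).sub (hsum _)).sub (hsum _)
  have hlog := fun L : StrongDual ℝ (SeqSpace p) => logChar_randomSeries hΛ hk hθ hindep hchar hs L
  rw [hlog, hlog, hlog, ← (hsum _).tsum_sub (hsum _),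
    ← ((hsum _).sub (hsum _)).tsum_sub (hsum _), ← hDeq,
    -- Below N the weight of M ∘ S is 0, and ψ(c - 0) - ψ(c) - ψ(0) = 0, so the sum starts at N.
    tsum_fin_prod_eq_sum_tsum_nat_add hDs.norm (N := N) fun i n hn => by
      simp [D, hM', hS.seriesCoeff_of_lt M i hn, levyExponent_zero]]
  have hbound : ∀ i n, ‖D (i, n + N)‖ ≤
      K * (‖L‖ ^ (r / 2) * ‖M‖ ^ (r / 2)) * (k n ^ (r / 2) * k (n + N) ^ (r / 2)) := fun i n => by
    have hK0 : 0 ≤ K := mul_nonneg (by positivity)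
      (integral_nonneg fun x => Real.rpow_nonneg (abs_nonneg x) r)
    have h1 := abs_seriesCoeff_le (k := k) L (i, n + N)
    have h2 := abs_seriesCoeff_le (k := k) M (i, n)
    rw [abs_of_nonneg (hk0 _)] at h1 h2
    have hr : 0 ≤ r / 2 := by positivity
    calc ‖D (i, n + N)‖
        ≤ K * (|seriesCoeff k L (i, n + N)| ^ (r / 2) * |seriesCoeff k M' (i, n + N)| ^ (r / 2)) :=
          norm_levyExponent_codifference_le hΛ hr0 hr2 hΛr _ _
      _ ≤ K * ((k (n + N) * ‖L‖) ^ (r / 2) * (k n * ‖M‖) ^ (r / 2)) := by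
          rw [hM', hS.seriesCoeff_add]
          have h3 : 0 ≤ (k (n + N) * ‖L‖) ^ (r / 2) :=
            Real.rpow_nonneg (mul_nonneg (hk0 _) (norm_nonneg _)) _
          gcongr
      _ = _ := by
          rw [Real.mul_rpow (hk0 _) (norm_nonneg _), Real.mul_rpow (hk0 _) (norm_nonneg _)]
          ring
  have htsum : ∀ i, ‖∑' n, D (i, n + N)‖ ≤ K * (‖L‖ ^ (r / 2) * ‖M‖ ^ (r / 2)) *
      ∑' l, k l ^ (r / 2) * k (l + N) ^ (r / 2) := fun i =>
    tsum_of_norm_bounded (hkr.hasSum.mul_left _) (hbound i)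
  refine (norm_sum_le _ _).trans ((Finset.sum_le_sum fun i _ => htsum i).trans_eq ?_)
  rw [Finset.sum_const, Finset.card_univ, Fintype.card_fin, nsmul_eq_mul, hK,
    show (3 : ℝ) - r = 1 + (2 - r) by ring, Real.rpow_add two_pos, Real.rpow_one]
  push_cast
  ring

end ShiftBy

/-! ### Coefficients and functionals -/

theorem shiftCoeff_pos {k₀ : ℝ} (hk₀ : 0 < k₀) {ω : ℕ → ℝ} (hpos : ∀ n, 0 < ω n) (n : ℕ) :
    0 < shiftCoeff k₀ ω n :=
  mul_pos hk₀ (Finset.prod_pos fun l _ => one_div_pos.2 (hpos l))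

theorem isShiftBy_backwardShift {p : ℝ≥0∞} [Fact (1 ≤ p)] (k₀ : ℝ) {ω : ℕ → ℝ}
    (hpos : ∀ n, 0 < ω n) (hbdd : BddAbove (Set.range ω)) :
    IsShiftBy (shiftCoeff k₀ ω) 1 (backwardShift p ω hpos hbdd) := by
  have hsmul : ∀ n (c : ℂ), seqSingle p n c = c • seqSingle p n 1 := fun n c => by
    rw [seqSingle, ← lp.single_smul, smul_eq_mul, mul_one]
  refine ⟨fun n hn c => ?_, fun n c => ?_⟩
  · obtain rfl : n = 0 := by omega
    rw [hsmul, map_smul, backwardShift_single_zero, smul_zero]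
  · rw [hsmul, map_smul, backwardShift_single_succ, hsmul n c, smul_smul, smul_smul, smul_smul]
    congr 1
    have h : (ω n : ℂ) ≠ 0 := by exact_mod_cast (hpos n).ne'
    rw [shiftCoeff, shiftCoeff, Finset.prod_range_succ]
    push_cast
    field_simp

theorem summable_rpow_of_summable_rpow {k : ℕ → ℝ} (hk0 : ∀ n, 0 ≤ k n) {a b : ℝ} (ha : 0 < a)
    (hab : a ≤ b) (hk : Summable fun n => k n ^ a) : Summable fun n => k n ^ b := by
  refine Summable.of_norm_bounded_eventually_nat hk ?_
  filter_upwards [hk.tendsto_atTop_zero.eventually_lt_const one_pos] with n hn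
  have h1 : k n ≤ 1 := by
    by_contra! h
    exact hn.not_ge (Real.one_le_rpow h.le ha.le)
  rw [Real.norm_of_nonneg (Real.rpow_nonneg (hk0 n) b)]
  rcases (hk0 n).eq_or_lt with h0 | h0
  · rw [← h0, Real.zero_rpow ha.ne', Real.zero_rpow (ha.trans_le hab).ne']
  · exact Real.rpow_le_rpow_of_exponent_ge h0 h1 hab

theorem summable_rpow_half_mul_shift {k : ℕ → ℝ} (hk0 : ∀ n, 0 ≤ k n) {r : ℝ}
    (hk : Summable fun n => k n ^ r) (n : ℕ) :
    Summable fun l => k l ^ (r / 2) * k (l + n) ^ (r / 2) := by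
  have hsq : ∀ l, (k l ^ (r / 2)) ^ 2 = k l ^ r := fun l => by
    rw [← Real.rpow_natCast, ← Real.rpow_mul (hk0 l)]
    norm_num
  refine Summable.of_nonneg_of_le
    (fun l => mul_nonneg (Real.rpow_nonneg (hk0 _) _) (Real.rpow_nonneg (hk0 _) _)) (fun l => ?_)
    (hk.add ((summable_nat_add_iff (f := fun l => k l ^ r) n).2 hk))
  rw [← hsq, ← hsq]
  nlinarith [sq_nonneg (k l ^ (r / 2) - k (l + n) ^ (r / 2)), sq_nonneg (k l ^ (r / 2)),
    sq_nonneg (k (l + n) ^ (r / 2))]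

section Functionals

variable {E : Type*} [NormedAddCommGroup E] [NormedSpace ℂ E]

/-- The real part of a complex functional. -/
noncomputable def reFunctional (x : StrongDual ℂ E) : StrongDual ℝ E :=
  Complex.reCLM.comp (x.restrictScalars ℝ)

/-- The imaginary part of a complex functional. -/
noncomputable def imFunctional (x : StrongDual ℂ E) : StrongDual ℝ E :=
  Complex.imCLM.comp (x.restrictScalars ℝ)

theorem norm_reFunctional_le (x : StrongDual ℂ E) : ‖reFunctional x‖ ≤ ‖x‖ :=
  ContinuousLinearMap.opNorm_le_bound _ (norm_nonneg _) fun z =>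
    (Complex.abs_re_le_norm (x z)).trans (x.le_opNorm z)

theorem norm_imFunctional_le (x : StrongDual ℂ E) : ‖imFunctional x‖ ≤ ‖x‖ :=
  ContinuousLinearMap.opNorm_le_bound _ (norm_nonneg _) fun z =>
    (Complex.abs_im_le_norm (x z)).trans (x.le_opNorm z)

end Functionals

/-- Passage from a bound on real functionals to the normalized bound. -/
theorem div_rpow_mul_le_of_norm_le {c K M r a b u v : ℝ} (hr : 0 ≤ r) (hK : 0 ≤ K) (hM : 0 ≤ M)
    (ha : 0 ≤ a) (hb : 0 ≤ b) (hau : a ≤ u) (hbv : b ≤ v) (hu : 0 < u) (hv : 0 < v)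
    (h : c ≤ 2 ^ (3 - 2 * r) * K * (a ^ r * b ^ r) * M) :
    c / (u ^ r * v ^ r) ≤ 2 ^ (5 - 2 * r) * K * M := by
  rw [div_le_iff₀ (by positivity)]
  calc c ≤ 2 ^ (3 - 2 * r) * K * (a ^ r * b ^ r) * M := h
    _ ≤ 2 ^ (5 - 2 * r) * K * (u ^ r * v ^ r) * M := by
        -- The exponent of 2 rises from 3 - 2r to 5 - 2r, which gives away a factor 4.
        gcongr
        · exact one_le_two
        · norm_num
    _ = _ := by ring

/-! ### Invariance, codifference bounds and mixing for the weighted shift -/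

theorem proposition6p4
    (α : ℝ) (hα0 : 0 < α) (hα1 : α < 1)
    (p : ℝ≥0∞) [Fact (1 ≤ p)] (hp2 : p ≤ 2)
    (aNeg aPos lNeg lPos : ℝ) (ham : 0 < aNeg) (hap : 0 < aPos) (hlm : 0 < lNeg) (hlp : 0 < lPos)
    (ω : ℕ → ℝ) (hpos : ∀ n, 0 < ω n) (hbdd : BddAbove (Set.range ω))
    (k₀ : ℝ) (hk₀ : 0 < k₀)
    (hk : Summable fun n => shiftCoeff k₀ ω n ^ α)
    {Ω : Type*} [MeasurableSpace Ω] (P : Measure Ω) [IsProbabilityMeasure P]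
    (θ : Fin 2 → ℕ → Ω → ℝ) (hθ : ∀ i n, Measurable (θ i n))
    (hindep : iIndepFun (fun q : Fin 2 × ℕ => θ q.1 q.2) P)
    (hlaw : ∀ i n, IsTemperedStable α aNeg aPos lNeg lPos (P.map (θ i n)))
    [MeasurableSpace (SeqSpace p)] [BorelSpace (SeqSpace p)] :
    let k : ℕ → ℝ := shiftCoeff k₀ ω
    let X : Ω → SeqSpace p := randomSeries p k θ
    let μ : Measure (SeqSpace p) := P.map X
    let T : SeqSpace p →L[ℂ] SeqSpace p := backwardShift p ω hpos hbdd
    -- the random series converges in `ℓ^p(ℕ)` almost surely, and `μ` is its law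
    ((∀ᵐ s ∂P, Summable (seriesTerm p k θ s)) ∧ AEMeasurable X P) ∧
    -- the logarithms in the codifferences of `μ` exist
    (∀ x : StrongDual ℂ (SeqSpace p), ∃ L, IsLogBranch (charPath μ fun z => (x z).re) L) ∧
    -- `μ` is invariant under `T`
    MeasurePreserving T μ μ ∧
    -- the codifference bounds, for all `n ≥ 0`
    (∀ n : ℕ,
      Summable (fun l => k l ^ (p.toReal / 2) * k (l + n) ^ (p.toReal / 2)) ∧
      ∀ x y : StrongDual ℂ (SeqSpace p), x ≠ 0 → y ≠ 0 →
        ‖codiffEq μ x (y.comp (T ^ n))‖ / (‖x‖ ^ (p.toReal / 2) * ‖y‖ ^ (p.toReal / 2)) ≤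
          2 ^ (5 - p.toReal) * (aNeg * lNeg ^ (α - p.toReal) + aPos * lPos ^ (α - p.toReal))
            * Real.Gamma (p.toReal - α)
            * ∑' l, k l ^ (p.toReal / 2) * k (l + n) ^ (p.toReal / 2) ∧
        ‖codiffNe μ x (y.comp (T ^ n))‖ / (‖x‖ ^ (p.toReal / 2) * ‖y‖ ^ (p.toReal / 2)) ≤
          2 ^ (5 - p.toReal) * (aNeg * lNeg ^ (α - p.toReal) + aPos * lPos ^ (α - p.toReal))
            * Real.Gamma (p.toReal - α)
            * ∑' l, k l ^ (p.toReal / 2) * k (l + n) ^ (p.toReal / 2)) ∧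
    -- mixing
    (Tendsto (fun n : ℕ => ∑' l, k l ^ (p.toReal / 2) * k (l + n) ^ (p.toReal / 2))
        atTop (𝓝 0) → IsStronglyMixing T μ) := by
  intro k X μ T
  have h1p : 1 ≤ p := Fact.out
  have hp : p ≠ ∞ := (hp2.trans_lt ENNReal.ofNat_lt_top).ne
  have hr1 : 1 ≤ p.toReal := by simpa using ENNReal.toReal_mono hp h1p
  have hr2 : p.toReal ≤ 2 := by simpa using ENNReal.toReal_mono ENNReal.ofNat_ne_top hp2
  have hr0 : 0 < p.toReal := one_pos.trans_le hr1
  set r := p.toReal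
  set Λ := temperedStableLevy α aNeg aPos lNeg lPos
  have hmoment := fun {q : ℝ} (hq : α < q) =>
    integral_temperedStableLevy_abs_rpow (α := α) ham hap hlm hlp hq
  -- The moments of orders 1, 2 and r are finite because α < 1 ≤ r.
  have hΛ : Integrable (fun x => |x|) Λ := by simpa using (hmoment hα1).1
  have hΛ2 : Integrable (fun x => |x| ^ (2 : ℝ)) Λ := (hmoment (by linarith)).1
  have hΛr : Integrable (fun x => |x| ^ r) Λ := (hmoment (by linarith)).1
  have hMr : ∫ x, |x| ^ r ∂Λ =
    (aNeg * lNeg ^ (α - r) + aPos * lPos ^ (α - r)) * Real.Gamma (r - α) :=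
    (hmoment (by linarith)).2
  have hkpos : ∀ n, 0 < k n := shiftCoeff_pos hk₀ hpos
  have hk0 : ∀ n, 0 ≤ k n := fun n => (hkpos n).le
  have hk1 : Summable fun n => |k n| := by
    simpa [abs_of_nonneg (hk0 _)] using summable_rpow_of_summable_rpow hk0 hα0 hα1.le hk
  have hkr := summable_rpow_half_mul_shift (r := r) hk0
    (summable_rpow_of_summable_rpow hk0 hα0 (by linarith) hk)
  have hchar : ∀ i n t, charFun (P.map (θ i n)) t = Complex.exp (levyExponent Λ t) :=
    fun i n => (hlaw i n).2
  have hs := ae_summable_mul hΛ hΛ2 hk1 hθ hchar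
  have hX : AEMeasurable X P := aemeasurable_randomSeries hθ hs
  have hT : IsShiftBy k 1 T := isShiftBy_backwardShift k₀ hpos hbdd
  have hTn := hT.pow fun n => (hkpos n).ne'
  have hTμ : MeasurePreserving T μ μ := hT.measurePreserving hp hΛ hk1 hθ hindep hchar hs
  refine ⟨⟨?_, hX⟩, fun x => ?_, hTμ, fun n => ⟨hkr n, fun x y hx hy => ?_⟩, fun _ =>
    isStronglyMixing_randomSeries (fun n => (hTn n).map_single_of_lt) hTμ hθ hindep hs⟩
  · filter_upwards [hs] with s hs
    exact (hasSum_randomSeries hs).summable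
  · exact ⟨_, isLogBranch_randomSeries hΛ hk1 hθ hindep hchar hs (reFunctional x)⟩
  · have hbound : ∀ c a b : ℝ, 0 ≤ a → 0 ≤ b → a ≤ ‖x‖ → b ≤ ‖y‖ →
        c ≤ 2 ^ (3 - r) * (∫ x, |x| ^ r ∂Λ) * (a ^ (r / 2) * b ^ (r / 2)) *
          ∑' l, k l ^ (r / 2) * k (l + n) ^ (r / 2) →
        c / (‖x‖ ^ (r / 2) * ‖y‖ ^ (r / 2)) ≤
          2 ^ (5 - r) * (aNeg * lNeg ^ (α - r) + aPos * lPos ^ (α - r)) * Real.Gamma (r - α)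
            * ∑' l, k l ^ (r / 2) * k (l + n) ^ (r / 2) := fun c a b ha0 hb0 ha hb h => by
      have h2 : 2 * (r / 2) = r := by ring
      have := div_rpow_mul_le_of_norm_le (c := c) (r := r / 2) (K := ∫ x, |x| ^ r ∂Λ)
        (M := ∑' l, k l ^ (r / 2) * k (l + n) ^ (r / 2)) (by positivity)
        (integral_nonneg fun x => Real.rpow_nonneg (abs_nonneg x) r)
        (tsum_nonneg fun l => mul_nonneg (Real.rpow_nonneg (hk0 _) _) (Real.rpow_nonneg (hk0 _) _))
        ha0 hb0 ha hb (norm_pos_iff.2 hx)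
        (norm_pos_iff.2 hy) (by rwa [h2])
      rwa [h2, hMr, ← mul_assoc (2 ^ (5 - r))] at this
    have hcod := (hTn n).norm_logChar_codifference_le hΛ hk1 hk0 hθ hindep hchar hs hr0 hr2 hΛr
      (hkr n) (reFunctional x)
    -- Both codifferences unfold to the form in `hcod`, with M the real part of y for the first and
    -- its imaginary part for the second; either part has norm at most ‖y‖.
    exact ⟨hbound _ _ _ (norm_nonneg _) (norm_nonneg _) (norm_reFunctional_le x)
        (norm_reFunctional_le y) (hcod (reFunctional y)),
      hbound _ _ _ (norm_nonneg _) (norm_nonneg _) (norm_reFunctional_le x)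
        (norm_imFunctional_le y) (hcod (imFunctional y))⟩
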